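/- Let $\mathbb F$ be a field of characteristic different from $2$. For a strictly lower triangular matrix $T=(t_{ij})\in M_n(\mathbb F)$ let $\mathcal A(T)$ be the commutative $\mathbb F$-algebra with generators $X_1,\dots,X_n$ and relations $X_1^2=0$, $X_i^2=\sum_{j<i}t_{ij}X_jX_i$ $(2\le i\le n)$, graded by $\deg X_i=2$. Write $T\sim S$ if there is a degree-preserving algebra isomorphism $\mathcal A(T)\cong\mathcal A(S)$, let $N_n$ be the (possibly infinite) number of $\sim$-classes of strictly lower triangular $n\times n$ matrices, and let $C_m=\frac1{m+1}\binom{2m}{m}$. Let $\mathcal P_{n-1}$ be the set of lattice paths with steps downwards and rightwards from the upper left to the lower right corner of the $(n-1)\times(n-1)$ square grid that do not pass above the diagonal; number the vertical lines $1,\dots,n$ from the left and the horizontal lines $2,3,\dots$ from the top. For $P\in\mathcal P_{n-1}$ let $\Psi(P)$ be the $n\times n$ matrix whose $(i,j)$ entry is $1$ if there is a node $(r,c)$ at which $P$ turns from rightwards to downwards with $r\le i$ and $j\le c$, and $0$ otherwise. Definitions. The leader of a nonzero row $r$ of $T$ is its last nonzero entry, in column $c_r$; put $c_r=0$ for a zero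 row. $T$ is *irreducible at its leaders* if for each nonzero row $r$ we have $c_r>1$ and $2t_{ri}+t_{rc_r}t_{c_ri}\ne0$ for some $i<c_r$. A nonzero $T$ is in 1-REF if its zero rows are above the nonzero ones, it is irreducible at its leaders, and $c_r\le c_{r+1}$ whenever rows $r,r+1$ are nonzero ($0$ is also in 1-REF). The wall of a nonzero $T$ in 1-REF is $(r_1,\dots,r_h)$, where $r_1$ is the first nonzero row, $r_{j+1}=\min\{r>r_j: c_r>r_j\}$, and the recursion stops when this set is empty; the wall of any $T$ is that of a 1-REF matrix equivalent to it. Put $r_0=1$, $r_{h+1}=n+1$, and for $r_q\le r<r_{q+1}$ let $\operatorname{supp}^{(q)}_r(T)=\{j: r_{q-1}\le j<r_q,\ t_{rj}\ne0\}$. A matrix $T\not\sim0$ with wall $(r_1,\dots,r_h)$ is in 2-REF if exactly its first $r_1-1$ rows are zero, it is irreducible at its leaders, $r_{q-1}\le c_r<r_q$ for $r_q\le r<r_{q+1}$, and $|\operatorname{supp}^{(q)}_r(T)|$ is weakly increasing in $r\in[r_q,r_{q+1})$ for every $q$. Its measure sequence is $(M_1,\dots,M_h)$, where $M_q$ is the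 two-row matrix listing the rows $r_{q1}=r_q<r_{q2}<\dots$ of $[r_q,r_{q+1})$ at which $|\operatorname{supp}^{(q)}_r(T)|$ strictly increases, above the corresponding cardinalities. If $T,S$ are in 2-REF with the same wall and measure sequence, we say that *the $(I,J)$-test separates $T$ from $S$* if there is no bijection $\rho$ of $\{1,\dots,n\}$ that maps each interval $[r_q,r_{q+1})$ and each interval $[r_{qk},r_{q,k+1})$ onto itself and satisfies $\rho(\operatorname{supp}^{(q)}_k(S))=\operatorname{supp}^{(q)}_{\rho(k)}(T)$ for all $1\le q\le h$ and all $k\in[r_q,r_{q+1})$. Then the following hold. 1. $N_n>C_{n-1}$ for every $n\ge4$. 2. Let $n\ge5$ and let $T$ be the $n\times n$ matrix with $t_{rc}=1$ if $4\le r<n$ and $c\in\{1,2\}$, or $r=n$ and $c\in\{1,3\}$, and $t_{rc}=0$ otherwise. Then $T\not\sim\Psi(P)$ for every $P\in\mathcal P_{n-1}$. Moreover, for the path $P_1\in\mathcal P_{n-1}$ whose only turn from rightwards to downwards is at $(4,2)$, both $T$ and $\Psi(P_1)$ are in 1-REF and in 2-REF, both have wall $(4)$ and measure sequence $\left(\begin{bmatrix}4\\2\end{bmatrix}\right)$,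 and the $(I,J)$-test separates $T$ from $\Psi(P_1)$. 3. For $u,v\in\mathbb F$ let $$S_{u,v}=\begin{bmatrix}0&0&0&0\\0&0&0&0\\1&1&0&0\\u&v&1&0\end{bmatrix}.$$ Then $S_{0,0}\sim S_{u,v}$ if and only if either $v\ne-\frac12$ and $u=-\frac{v}{2v+1}$, or $u\ne-\frac12$ and $v=-\frac{u}{2u+1}$. Moreover $S_{0,0}\not\sim\Psi(P)$ for every $P\in\mathcal P_3$. -/

import Mathlib

/-! Nil graded algebras attached to strictly lower triangular matrices.
Rows and columns are numbered from 1 (as usual on paper) through `ent`. -/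

/-- Strictly lower triangular `n × n` matrices over `F`. -/
abbrev SLTM (n : ℕ) (F : Type*) [Field F] : Type _ :=
  {T : Matrix (Fin n) (Fin n) F // ∀ i j, i ≤ j → T i j = 0}

namespace SLTM

noncomputable section

/-- The strictly lower triangular matrix whose entry in position `(r, c)`, `1 ≤ c < r ≤ n`
(positions counted from 1), is `f r c`. -/
def ofEntries (n : ℕ) (F : Type*) [Field F] (f : ℕ → ℕ → F) : SLTM n F :=
  ⟨Matrix.of fun i j => if j < i then f (i.val + 1) (j.val + 1) else 0,
    fun i j h => by simp [not_lt.mpr h]⟩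

/-- The entry in row `r` and column `c`, both counted from 1 (and `0` out of range). -/
def ent {n : ℕ} {F : Type*} [Field F] (T : SLTM n F) (r c : ℕ) : F :=
  if h : (1 ≤ r ∧ r ≤ n) ∧ (1 ≤ c ∧ c ≤ n) then
    T.1 ⟨r - 1, by omega⟩ ⟨c - 1, by omega⟩
  else 0

/-! ### The algebra of a matrix and the isomorphism relation -/

/-- The ideal of the relations `X_i ^ 2 = ∑_{j < i} t_{ij} X_j X_i`
(for the first index the sum is empty). -/
def relIdeal {n : ℕ} {F : Type*} [Field F] (T : SLTM n F) : Ideal (MvPolynomial (Fin n) F) :=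
  Ideal.span (Set.range fun i : Fin n =>
    MvPolynomial.X i ^ 2 -
      ∑ j ∈ Finset.univ.filter (fun j : Fin n => j < i),
        MvPolynomial.C (T.1 i j) * MvPolynomial.X j * MvPolynomial.X i)

/-- The nil graded algebra of `T`. -/
abbrev Alg {n : ℕ} {F : Type*} [Field F] (T : SLTM n F) : Type _ :=
  MvPolynomial (Fin n) F ⧸ relIdeal T

/-- The homogeneous elements of degree `d` of the algebra of `T`, for the grading in which
every generator has degree 2. -/
def gradedPiece {n : ℕ} {F : Type*} [Field F] (T : SLTM n F) (d : ℕ) : Submodule F (Alg T) :=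
  (MvPolynomial.weightedHomogeneousSubmodule F (fun _ : Fin n => 2) d).map
    (Ideal.Quotient.mkₐ F (relIdeal T)).toLinearMap

/-- `T ∼ S`: there is an isomorphism of algebras which, like its inverse, preserves degrees. -/
def Sim {n : ℕ} {F : Type*} [Field F] (T S : SLTM n F) : Prop :=
  ∃ e : Alg T ≃ₐ[F] Alg S, ∀ (d : ℕ) (x : Alg T), x ∈ gradedPiece T d ↔ e x ∈ gradedPiece S d

theorem sim_equivalence (n : ℕ) (F : Type*) [Field F] :
    Equivalence (Sim (n := n) (F := F)) where
  refl T := ⟨AlgEquiv.refl, fun _ _ => Iff.rfl⟩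
  symm := by
    rintro T S ⟨e, he⟩
    exact ⟨e.symm, fun d x => by rw [he d (e.symm x), e.apply_symm_apply]⟩
  trans := by
    rintro T S U ⟨e, he⟩ ⟨f, hf⟩
    exact ⟨e.trans f, fun d x => by rw [he d x, hf d (e x)]; rfl⟩

/-- The relation `∼` as a setoid. -/
def simSetoid (n : ℕ) (F : Type*) [Field F] : Setoid (SLTM n F) :=
  ⟨Sim, sim_equivalence n F⟩

/-- The number (a cardinal, possibly infinite) of classes of strictly lower triangular
`n × n` matrices under `∼`. -/
def numClasses (n : ℕ) (F : Type*) [Field F] : Cardinal :=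
  Cardinal.mk (Quotient (simSetoid n F))

/-! ### First reduced echelon form and wall -/

open Classical in
/-- The column of the last nonzero entry of row `r`, or `0` if row `r` is zero. -/
def leaderCol {n : ℕ} {F : Type*} [Field F] (T : SLTM n F) (r : ℕ) : ℕ :=
  ((Finset.Icc 1 n).filter fun c => T.ent r c ≠ 0).sup id

/-- `Δ^{(α)}_{i,j,k}(T) = α t_{ki} + t_{kj} t_{ji}`. -/
def delta {n : ℕ} {F : Type*} [Field F] (α : F) (i j k : ℕ) (T : SLTM n F) : F :=
  α * T.ent k i + T.ent k j * T.ent j i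

/-- No leader is in the first column, and no leader can be cancelled. -/
def LeadersIrreducible {n : ℕ} {F : Type*} [Field F] (T : SLTM n F) : Prop :=
  ∀ r ∈ Set.Icc 1 n, T.leaderCol r ≠ 0 →
    1 < T.leaderCol r ∧ ∃ i ∈ Set.Ico 1 (T.leaderCol r), delta 2 i (T.leaderCol r) r T ≠ 0

/-- First reduced echelon form. -/
def IsREF1 {n : ℕ} {F : Type*} [Field F] (T : SLTM n F) : Prop :=
  T.1 = 0 ∨
    ((∀ r ∈ Set.Icc 1 n, ∀ s ∈ Set.Icc 1 n,
        T.leaderCol r = 0 → T.leaderCol s ≠ 0 → r < s) ∧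
      T.LeadersIrreducible ∧
      ∀ r ∈ Set.Ico 1 n, T.leaderCol r ≠ 0 → T.leaderCol (r + 1) ≠ 0 →
        T.leaderCol r ≤ T.leaderCol (r + 1))

/-- `WallFrom T r w`: the recursion defining the wall, started at `r_j = r`, produces
`w = (r_j, r_{j+1}, …, r_h)`. -/
inductive WallFrom {n : ℕ} {F : Type*} [Field F] (T : SLTM n F) : ℕ → List ℕ → Prop
  | last (r : ℕ) (h : ∀ s ∈ Set.Ioc r n, T.leaderCol s ≤ r) : WallFrom T r [r]
  | step (r s : ℕ) (w : List ℕ) (h : IsLeast {s ∈ Set.Ioc r n | r < T.leaderCol s} s)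
      (hw : WallFrom T s w) : WallFrom T r (r :: w)

/-- `w` is the wall of the matrix `T` in first reduced echelon form; the zero matrix has
wall `(0)`. -/
def IsWallREF1 {n : ℕ} {F : Type*} [Field F] (T : SLTM n F) (w : List ℕ) : Prop :=
  T.IsREF1 ∧
    ((T.1 = 0 ∧ w = [0]) ∨
      ∃ r, IsLeast {r ∈ Set.Icc 1 n | T.leaderCol r ≠ 0} r ∧ WallFrom T r w)

/-- `w` is the wall of `T`: it is the wall of some matrix in first reduced echelon form that is
equivalent to `T`. -/
def HasWall {n : ℕ} {F : Type*} [Field F] (T : SLTM n F) (w : List ℕ) : Prop :=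
  ∃ S : SLTM n F, Sim T S ∧ S.IsWallREF1 w

/-- For `w = (r_1, …, r_h)`: `wallAt n w j = r_j`, where `r_0 = 1` and `r_{h+1} = n + 1`. -/
def wallAt (n : ℕ) (w : List ℕ) (j : ℕ) : ℕ :=
  (1 :: (w ++ [n + 1])).getD j 0

/-! ### Second reduced echelon form and measure sequence -/

/-- The columns `c` with `r_{j-1} ≤ c < r_j` in which row `r` has a nonzero entry. -/
def brickSupp {n : ℕ} {F : Type*} [Field F] (T : SLTM n F) (w : List ℕ) (j r : ℕ) : Set ℕ :=
  {c ∈ Set.Ico (wallAt n w (j - 1)) (wallAt n w j) | T.ent r c ≠ 0}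

/-- The measure of the part of row `r` in the columns of the `j`-th brick. -/
def brickMeasure {n : ℕ} {F : Type*} [Field F] (T : SLTM n F) (w : List ℕ) (j r : ℕ) : ℕ :=
  (T.brickSupp w j r).ncard

/-- `T` has wall `w = (r_1, …, r_h)` and is in second reduced echelon form, `T ≁ 0`. -/
def IsREF2With {n : ℕ} {F : Type*} [Field F] (T : SLTM n F) (w : List ℕ) : Prop :=
  (¬ Sim T ⟨0, fun _ _ _ => rfl⟩) ∧ T.HasWall w ∧
    (∀ r ∈ Set.Icc 1 n, T.leaderCol r = 0 ↔ r < wallAt n w 1) ∧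
    T.LeadersIrreducible ∧
    (∀ j ∈ Set.Icc 1 w.length, ∀ r ∈ Set.Ico (wallAt n w j) (wallAt n w (j + 1)),
      T.leaderCol r ∈ Set.Ico (wallAt n w (j - 1)) (wallAt n w j)) ∧
    ∀ j ∈ Set.Icc 1 w.length, ∀ r, wallAt n w j ≤ r → r + 1 < wallAt n w (j + 1) →
      T.brickMeasure w j r ≤ T.brickMeasure w j (r + 1)

/-- `MeasureFrom T w j r M`: the recursion defining the columns `(r_{jk}, μ_{jk})` of the `j`-th
matrix of the measure sequence, started at `r_{jk} = r`, produces the list of columns `M`. -/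
inductive MeasureFrom {n : ℕ} {F : Type*} [Field F] (T : SLTM n F) (w : List ℕ) (j : ℕ) :
    ℕ → List (ℕ × ℕ) → Prop
  | last (r : ℕ)
      (h : ∀ s ∈ Set.Ioo r (wallAt n w (j + 1)), T.brickMeasure w j s ≤ T.brickMeasure w j r) :
      MeasureFrom T w j r [(r, T.brickMeasure w j r)]
  | step (r s : ℕ) (M : List (ℕ × ℕ))
      (h : IsLeast {s ∈ Set.Ioo r (wallAt n w (j + 1)) |
        T.brickMeasure w j r < T.brickMeasure w j s} s)
      (hM : MeasureFrom T w j s M) : MeasureFrom T w j r ((r, T.brickMeasure w j r) :: M)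

/-- `M = (M_1, …, M_h)` is the measure sequence of the matrix `T` in second reduced echelon form
with wall `w`; each `2 × l` matrix `M_j` is given as the list of its columns. -/
def IsMeasureSeq {n : ℕ} {F : Type*} [Field F] (T : SLTM n F) (w : List ℕ)
    (M : List (List (ℕ × ℕ))) : Prop :=
  M.length = w.length ∧
    ∀ j ∈ Set.Icc 1 w.length, MeasureFrom T w j (wallAt n w j) (M.getD (j - 1) [])

/-- There is a bijection `ρ` of `[1, n]` which stabilizes the intervals prescribed by the common
wall `w` and the common measure sequence `M` of `T` and `S` and which satisfies
`ρ (I_k^{(q)}) = J_{ρ k}^{(q)}`, where `J` are the supports for `T` and `I` those for `S`. -/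
def IJCompatible {n : ℕ} {F : Type*} [Field F] (T S : SLTM n F) (w : List ℕ)
    (M : List (List (ℕ × ℕ))) : Prop :=
  ∃ ρ : ℕ → ℕ, Set.BijOn ρ (Set.Icc 1 n) (Set.Icc 1 n) ∧
    (∀ j ∈ Set.Icc 1 w.length,
      ρ '' Set.Ico (wallAt n w j) (wallAt n w (j + 1)) =
        Set.Ico (wallAt n w j) (wallAt n w (j + 1))) ∧
    (∀ Mj ∈ M, ∀ i, i + 1 < Mj.length →
      ρ '' Set.Ico (Mj.getD i (0, 0)).1 (Mj.getD (i + 1) (0, 0)).1 =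
        Set.Ico (Mj.getD i (0, 0)).1 (Mj.getD (i + 1) (0, 0)).1) ∧
    ∀ q ∈ Set.Icc 1 w.length, ∀ k ∈ Set.Ico (wallAt n w q) (wallAt n w (q + 1)),
      ρ '' S.brickSupp w q k = T.brickSupp w q (ρ k)

/-! ### Lattice paths and their matrices -/

/-- A monotonic lattice path in the `m × m` grid from the upper left to the lower right corner
which does not pass above the diagonal is a Dyck word of semilength `m`, with `U` read as a step
downwards and `D` as a step rightwards.

`IsTurn P r c`: at the node `(r, c)` the path changes its direction from rightwards to downwards.
The vertical lines are numbered `1, 2, …` from the left, the horizontal ones `2, 3, …` from the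
top. -/
def IsTurn (P : DyckWord) (r c : ℕ) : Prop :=
  ∃ a b : List DyckStep, P.toList = a ++ DyckStep.D :: DyckStep.U :: b ∧
    r = a.count DyckStep.U + 2 ∧ c = a.count DyckStep.D + 2

/-- Turning nodes lie strictly below the main diagonal of the matrix. -/
theorem IsTurn.lt {P : DyckWord} {r c : ℕ} (h : IsTurn P r c) : c < r := by
  obtain ⟨a, b, hP, rfl, rfl⟩ := h
  have h1 := P.count_D_le_count_U (a.length + 1)
  have h2 : P.toList.take (a.length + 1) = a ++ [DyckStep.D] := by
    rw [hP, List.take_append]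
    simp
  rw [h2] at h1
  simp at h1
  omega

open Classical in
/-- The matrix `Ψ(P)` of a path `P` in the `(n-1) × (n-1)` grid: the entry at `(i, j)` is `1` if
the node `(i, j)` belongs to the lower zone of `P`, i.e. lies weakly below and weakly to the left of
a node where `P` turns from rightwards to downwards, and `0` otherwise. -/
def Psi (n : ℕ) (F : Type*) [Field F] (P : DyckWord) : SLTM n F :=
  ofEntries n F fun i j => if ∃ r c, IsTurn P r c ∧ r ≤ i ∧ j ≤ c then 1 else 0

/-! ### The explicit matrices -/

/-- The matrix with `t_{rc} = 1` if `4 ≤ r < n` and `c ∈ {1, 2}`, or `r = n` and `c ∈ {1, 3}`, and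
`t_{rc} = 0` otherwise. -/
def extra (n : ℕ) (F : Type*) [Field F] : SLTM n F :=
  ofEntries n F fun r c =>
    if (4 ≤ r ∧ r < n ∧ (c = 1 ∨ c = 2)) ∨ (r = n ∧ (c = 1 ∨ c = 3)) then 1 else 0

/-- The `4 × 4` matrix with rows `0`, `0`, `(1, 1, 0, 0)`, `(u, v, 1, 0)`. -/
def fourMat (F : Type*) [Field F] (u v : F) : SLTM 4 F :=
  ⟨!![0, 0, 0, 0;
      0, 0, 0, 0;
      1, 1, 0, 0;
      u, v, 1, 0], by
    intro i j h
    fin_cases i <;> fin_cases j <;> simp_all⟩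

end

end SLTM

/-! Equivalences are controlled by degrees 2 and 4 alone. Degree 2 is the space of linear forms,
with the generators as a basis (`lin_injective`), and for j < k the coefficient of X_j X_k in a
product of linear forms is a well-defined functional `co`.

Let R_r be the linear form of row r. Completing the square, Z_r = 2X_r - R_r satisfies Z_r² = R_r².
Conversely, if V_m is the span of the first m generators, a linear form outside V_m whose square
lies in V_m² is a multiple of some Z_r (`exists_eq_smul_sgen`). Hence a graded isomorphism
preserving V_m carries such Z_r to multiples of such Z_s. If the rows concerned are exactly those
supported in the first m columns, their number m' is the same on both sides and V_{m'} is preserved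
too (`Compat.next`). Starting from V_0 = 0, this gives a filtration respected by every graded
isomorphism. Comparing R_r² with the image of its partner then transports products of two entries of
a row (`entries_mul_eq`), hence supports, up to a permutation inside a layer.

For staircase matrices the row lengths therefore become invariants (`Full.eq_of_sim`). Staircases
with last entries -1 have irreducible leaders in every characteristic other than 2, so Dyck words
provide Catalan many classes, and one further class makes the bound strict. For n ≥ 5 this is
`extra`: two of its rows have the non-nested supports {1,2} and {1,3}, whereas the supports in a
staircase are nested. For n = 4 it is `fourMat F 0 0`, where supports do not suffice; eliminating
the scalars of a hypothetical isomorphism leaves a quadratic equation on the last row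
(`quadratic_of_fourMat_sim`). The same equation is the necessary condition in the third claim, and
an explicit linear substitution shows its sufficiency. -/

/-! ### Linear and quadratic coordinates on the algebra of a matrix -/

namespace SLTM

/-- The generators of the algebra of `T`. -/
noncomputable def gen {n : ℕ} {F : Type*} [Field F] (T : SLTM n F) (i : Fin n) : Alg T :=
  Ideal.Quotient.mkₐ F (relIdeal T) (MvPolynomial.X i)

/-- The linear form with coefficients `a`. -/
noncomputable def lin {n : ℕ} {F : Type*} [Field F] (T : SLTM n F) :
    (Fin n → F) →ₗ[F] Alg T :=
  Fintype.linearCombination F (gen T)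

theorem lin_apply {n : ℕ} {F : Type*} [Field F] (T : SLTM n F) (a : Fin n → F) :
    lin T a = ∑ i, a i • gen T i := rfl

theorem lin_single {n : ℕ} {F : Type*} [Field F] (T : SLTM n F) (i : Fin n) (x : F) :
    lin T (Pi.single i x) = x • gen T i := by
  simp [lin]

theorem gen_mul_self {n : ℕ} {F : Type*} [Field F] (T : SLTM n F) (i : Fin n) :
    gen T i * gen T i = lin T (T.1 i) * gen T i := by
  have h : Ideal.Quotient.mkₐ F (relIdeal T) (MvPolynomial.X i ^ 2) =
      Ideal.Quotient.mkₐ F (relIdeal T) (∑ j ∈ Finset.univ.filter (fun j : Fin n => j < i),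
        MvPolynomial.C (T.1 i j) * MvPolynomial.X j * MvPolynomial.X i) :=
    Ideal.Quotient.eq.2 (Ideal.subset_span ⟨i, rfl⟩)
  rw [pow_two, map_mul, map_sum, Finset.sum_filter] at h
  refine h.trans ?_
  rw [lin_apply, Finset.sum_mul]
  refine Finset.sum_congr rfl fun j _ => ?_
  split_ifs with hj
  · rw [map_mul, map_mul, ← MvPolynomial.algebraMap_eq, AlgHom.commutes, ← Algebra.smul_def]
    rfl
  · rw [T.2 i j (not_lt.mp hj), zero_smul, zero_mul]

/-- An algebra map out of the algebra of `T` from images of the generators that satisfy the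
relations. -/
noncomputable def liftAlg {n : ℕ} {F : Type*} [Field F] (T : SLTM n F) {A : Type*} [CommRing A]
    [Algebra F A] (g : Fin n → A) (hg : ∀ i, g i * g i = (∑ j, T.1 i j • g j) * g i) :
    Alg T →ₐ[F] A :=
  Ideal.Quotient.liftₐ (relIdeal T) (MvPolynomial.aeval g) (by
    have : relIdeal T ≤ RingHom.ker (MvPolynomial.aeval (R := F) g) := by
      refine Ideal.span_le.2 ?_
      rintro _ ⟨i, rfl⟩
      simp only [SetLike.mem_coe, RingHom.mem_ker, map_sub, map_pow, map_sum, map_mul,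
        MvPolynomial.aeval_X, MvPolynomial.aeval_C]
      rw [pow_two, hg i, Finset.sum_filter, Finset.sum_mul, sub_eq_zero]
      refine Finset.sum_congr rfl fun j _ => ?_
      split_ifs with hj
      · rw [Algebra.smul_def]
      · rw [T.2 i j (not_lt.mp hj), zero_smul, zero_mul]
    exact fun a ha => this ha)

theorem liftAlg_gen {n : ℕ} {F : Type*} [Field F] (T : SLTM n F) {A : Type*} [CommRing A]
    [Algebra F A] (g : Fin n → A) (hg : ∀ i, g i * g i = (∑ j, T.1 i j • g j) * g i)
    (i : Fin n) : liftAlg T g hg (gen T i) = g i :=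
  MvPolynomial.aeval_X (R := F) g i

theorem liftAlg_lin {n : ℕ} {F : Type*} [Field F] (T : SLTM n F) {A : Type*} [CommRing A]
    [Algebra F A] (g : Fin n → A) (hg : ∀ i, g i * g i = (∑ j, T.1 i j • g j) * g i)
    (a : Fin n → F) : liftAlg T g hg (lin T a) = ∑ i, a i • g i := by
  simp [lin_apply, map_sum, map_smul, liftAlg_gen]

/-- The `i`-th coordinate of a linear form. -/
noncomputable def coord {n : ℕ} {F : Type*} [Field F] (T : SLTM n F) (i : Fin n) :
    Alg T →ₗ[F] F :=
  (TrivSqZeroExt.sndHom F F) ∘ₗ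
    (liftAlg T (A := DualNumber F) (fun k => if k = i then DualNumber.eps else 0) (by
      intro k
      split_ifs with hk
      · subst hk
        rw [Finset.sum_eq_zero, zero_mul, DualNumber.eps_mul_eps]
        intro j _
        split_ifs with hj
        · rw [hj, T.2 k k le_rfl, zero_smul]
        · rw [smul_zero]
      · simp)).toLinearMap

theorem coord_lin {n : ℕ} {F : Type*} [Field F] (T : SLTM n F) (i : Fin n) (a : Fin n → F) :
    coord T i (lin T a) = a i := by
  simp only [coord, LinearMap.comp_apply, AlgHom.toLinearMap_apply, liftAlg_lin, smul_ite,
    smul_zero, Finset.sum_ite_eq', Finset.mem_univ, if_true]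
  simp

theorem lin_injective {n : ℕ} {F : Type*} [Field F] (T : SLTM n F) :
    Function.Injective (lin T) := fun a b h => by
  ext i
  rw [← coord_lin T i a, h, coord_lin]

/-- The images of the generators under the map which reads off the coefficient of
`X_j X_k`. -/
noncomputable def coGen {n : ℕ} {F : Type*} [Field F] (T : SLTM n F) (j k i : Fin n) :
    DualNumber (DualNumber F) :=
  if i = j then TrivSqZeroExt.inl DualNumber.eps
  else if i = k then DualNumber.eps + TrivSqZeroExt.inl ((T.1 k j / 2) • DualNumber.eps)
  else 0

theorem sum_smul_coGen {n : ℕ} {F : Type*} [Field F] (T : SLTM n F) {j k : Fin n} (hjk : j < k)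
    (a : Fin n → F) : ∑ i, a i • coGen T j k i =
      a j • coGen T j k j + a k • coGen T j k k := by
  rw [← Finset.sum_pair (f := fun i => a i • coGen T j k i) hjk.ne]
  refine (Finset.sum_subset (Finset.subset_univ _) ?_).symm
  intro i _ hi
  simp only [Finset.mem_insert, Finset.mem_singleton, not_or] at hi
  simp [coGen, hi.1, hi.2]

/-- With ε the inner and η the outer infinitesimal, X_j ↦ ε, X_k ↦ η + (t_kj/2)ε, and all other
generators vanish. The halved term is forced by (η + tε/2)² = tεη, which has to equal t times the
image of X_j X_k. -/
theorem coGen_rel {n : ℕ} {F : Type*} [Field F] (h2 : (2 : F) ≠ 0) (T : SLTM n F) {j k : Fin n}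
    (hjk : j < k) (i : Fin n) :
    coGen T j k i * coGen T j k i = (∑ l, T.1 i l • coGen T j k l) * coGen T j k i := by
  rw [sum_smul_coGen T hjk]
  by_cases hj : i = j
  · subst hj
    rw [T.2 i i le_rfl, T.2 i k hjk.le]
    ext <;> simp [coGen]
  · by_cases hk : i = k
    · subst hk
      rw [T.2 i i le_rfl]
      ext <;> simp [coGen, hjk.ne']
      field_simp
      ring
    · simp [coGen, hj, hk]

open Classical in
/-- The coefficient of `X_j X_k`, `j < k`, of a quadratic element. -/
noncomputable def co {n : ℕ} {F : Type*} [Field F] (T : SLTM n F) (j k : Fin n) :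
    Alg T →ₗ[F] F :=
  if h : j < k ∧ (2 : F) ≠ 0 then
    (TrivSqZeroExt.sndHom F F) ∘ₗ
      ((TrivSqZeroExt.sndHom (DualNumber F) (DualNumber F)).restrictScalars F) ∘ₗ
      (liftAlg T (coGen T j k) (coGen_rel h.2 T h.1)).toLinearMap
  else 0

theorem co_lin_mul_lin {n : ℕ} {F : Type*} [Field F] (h2 : (2 : F) ≠ 0) (T : SLTM n F)
    {j k : Fin n} (hjk : j < k) (a b : Fin n → F) :
    co T j k (lin T a * lin T b) = a j * b k + a k * b j + a k * b k * T.1 k j := by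
  rw [co, dif_pos ⟨hjk, h2⟩]
  simp only [LinearMap.comp_apply, AlgHom.toLinearMap_apply, map_mul, liftAlg_lin,
    sum_smul_coGen T hjk]
  simp [coGen, hjk.ne']
  field_simp
  ring

theorem exists_lin_of_mem_gradedPiece {n : ℕ} {F : Type*} [Field F] {T : SLTM n F} {x : Alg T}
    (hx : x ∈ gradedPiece T 2) : ∃ a, x = lin T a := by
  obtain ⟨f, hf, rfl⟩ := hx
  suffices h : (Ideal.Quotient.mkₐ F (relIdeal T)) f ∈ LinearMap.range (lin T) by
    obtain ⟨a, ha⟩ := h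
    exact ⟨a, ha.symm⟩
  rw [f.as_sum, map_sum]
  refine Submodule.sum_mem _ fun m hm => ?_
  have hw := hf (MvPolynomial.mem_support_iff.1 hm)
  -- All generators have weight 2, so a monomial of weight 2 is a single generator.
  have hm1 : m.sum (fun _ k => k) = 1 := by
    have : Finsupp.weight (fun _ : Fin n => 2) m = m.sum (fun _ k => k) * 2 := by
      simp [Finsupp.weight_apply, Finsupp.sum, Finset.sum_mul]
    omega
  obtain ⟨i, rfl⟩ := (Finsupp.sum_eq_one_iff m).1 hm1
  refine ⟨Pi.single i (MvPolynomial.coeff (Finsupp.single i 1) f), ?_⟩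
  rw [lin_single, ← mul_one (MvPolynomial.coeff (Finsupp.single i 1) f),
    ← smul_eq_mul, ← MvPolynomial.smul_monomial, map_smul]
  simp only [smul_eq_mul, mul_one]
  rfl

theorem lin_mem_gradedPiece {n : ℕ} {F : Type*} [Field F] (T : SLTM n F) (a : Fin n → F) :
    lin T a ∈ gradedPiece T 2 := by
  rw [lin_apply]
  refine Submodule.sum_mem _ fun i _ => Submodule.smul_mem _ _ ⟨MvPolynomial.X i, ?_, rfl⟩
  exact MvPolynomial.isWeightedHomogeneous_X F _ i

/-! ### Graded isomorphisms and the filtration by initial generators -/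

/-- The isomorphism `e` preserves degrees in both directions. -/
def IsGr {n : ℕ} {F : Type*} [Field F] {T S : SLTM n F} (e : Alg T ≃ₐ[F] Alg S) : Prop :=
  ∀ (d : ℕ) (x : Alg T), x ∈ gradedPiece T d ↔ e x ∈ gradedPiece S d

theorem IsGr.symm {n : ℕ} {F : Type*} [Field F] {T S : SLTM n F} {e : Alg T ≃ₐ[F] Alg S}
    (he : IsGr e) : IsGr e.symm := fun d x => by
  rw [he d (e.symm x), e.apply_symm_apply]

theorem IsGr.exists_lin {n : ℕ} {F : Type*} [Field F] {T S : SLTM n F} {e : Alg T ≃ₐ[F] Alg S}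
    (he : IsGr e) (a : Fin n → F) : ∃ b, e (lin T a) = lin S b :=
  exists_lin_of_mem_gradedPiece ((he 2 _).1 (lin_mem_gradedPiece T a))

/-- The span of the first `m` generators. -/
noncomputable def initial {n : ℕ} {F : Type*} [Field F] (T : SLTM n F) (m : ℕ) :
    Submodule F (Alg T) :=
  Submodule.map (lin T)
    { carrier := {a | ∀ i : Fin n, m ≤ i → a i = 0}
      add_mem' := fun ha hb i hi => by simp [ha i hi, hb i hi]
      zero_mem' := fun _ _ => rfl
      smul_mem' := fun x a ha i hi => by simp [ha i hi] }

theorem lin_mem_initial {n : ℕ} {F : Type*} [Field F] {T : SLTM n F} {m : ℕ} {a : Fin n → F} :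
    lin T a ∈ initial T m ↔ ∀ i : Fin n, m ≤ i → a i = 0 := by
  constructor
  · rintro ⟨b, hb, h⟩
    rw [← lin_injective T h]
    exact hb
  · exact fun h => ⟨a, h, rfl⟩

theorem exists_lin_of_mem_initial {n : ℕ} {F : Type*} [Field F] {T : SLTM n F} {m : ℕ}
    {x : Alg T} (hx : x ∈ initial T m) :
    ∃ a : Fin n → F, (∀ i : Fin n, m ≤ i → a i = 0) ∧ x = lin T a := by
  obtain ⟨a, ha, rfl⟩ := hx
  exact ⟨a, ha, rfl⟩

theorem coord_initial {n : ℕ} {F : Type*} [Field F] {T : SLTM n F} {m : ℕ} {x : Alg T}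
    (hx : x ∈ initial T m) {i : Fin n} (hi : m ≤ i) : coord T i x = 0 := by
  obtain ⟨a, ha, rfl⟩ := exists_lin_of_mem_initial hx
  rw [coord_lin, ha i hi]

/-- Every term of the coefficient formula, including the correction a_k b_k t_kj, contains a
coordinate at the larger index k. It therefore suffices that k lies outside the initial segment. -/
theorem co_initial_mul {n : ℕ} {F : Type*} [Field F] (h2 : (2 : F) ≠ 0) {T : SLTM n F} {m : ℕ}
    {j k : Fin n} (hjk : j < k) (hk : m ≤ k) {x : Alg T}
    (hx : x ∈ initial T m * initial T m) : co T j k x = 0 := by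
  refine Submodule.mul_induction_on hx ?_ ?_
  · intro y hy z hz
    obtain ⟨a, ha, rfl⟩ := exists_lin_of_mem_initial hy
    obtain ⟨b, hb, rfl⟩ := exists_lin_of_mem_initial hz
    rw [co_lin_mul_lin h2 T hjk, ha k hk, hb k hk]
    simp
  · intro y z hy hz
    rw [map_add, hy, hz, add_zero]

/-! ### Completing the square -/

/-- The linear form given by row `r`. -/
noncomputable def rowForm {n : ℕ} {F : Type*} [Field F] (T : SLTM n F) (r : Fin n) : Alg T :=
  lin T (T.1 r)

/-- The generators after completion of squares. -/
noncomputable def sgen {n : ℕ} {F : Type*} [Field F] (T : SLTM n F) (r : Fin n) : Alg T :=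
  lin T (Pi.single r 2 - T.1 r)

theorem sgen_eq {n : ℕ} {F : Type*} [Field F] (T : SLTM n F) (r : Fin n) :
    sgen T r = (2 : F) • gen T r - rowForm T r := by
  rw [sgen, map_sub, lin_single, rowForm]

theorem sgen_mul_self {n : ℕ} {F : Type*} [Field F] (T : SLTM n F) (r : Fin n) :
    sgen T r * sgen T r = rowForm T r * rowForm T r := by
  have h := gen_mul_self T r
  have h' : sgen T r = 2 * gen T r - rowForm T r := by rw [sgen_eq, two_smul, two_mul]
  rw [h']
  change gen T r * gen T r = rowForm T r * gen T r at h
  linear_combination 4 * h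

theorem coord_sgen_self {n : ℕ} {F : Type*} [Field F] (T : SLTM n F) (r : Fin n) :
    coord T r (sgen T r) = 2 := by
  rw [sgen, coord_lin]
  simp [T.2 r r le_rfl]

theorem coord_sgen_of_lt {n : ℕ} {F : Type*} [Field F] (T : SLTM n F) {r i : Fin n}
    (h : r < i) : coord T i (sgen T r) = 0 := by
  rw [sgen, coord_lin]
  simp [T.2 r i h.le, h.ne']

theorem coord_sgen_of_ne {n : ℕ} {F : Type*} [Field F] (T : SLTM n F) {r i : Fin n}
    (h : i ≠ r) : coord T i (sgen T r) = - T.1 r i := by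
  rw [sgen, coord_lin]
  simp [h]

theorem sgen_mem_initial {n : ℕ} {F : Type*} [Field F] (h2 : (2 : F) ≠ 0) {T : SLTM n F} {m : ℕ}
    {r : Fin n} : sgen T r ∈ initial T m ↔ (r : ℕ) < m := by
  constructor
  · intro h
    by_contra hr
    exact h2 ((coord_sgen_self T r).symm.trans (coord_initial h (not_lt.mp hr)))
  · intro h
    refine lin_mem_initial.2 fun i hi => ?_
    have hri : r < i := Fin.lt_def.2 (h.trans_le hi)
    simp [T.2 r i hri.le, hri.ne']

theorem eq_of_smul_sgen_eq {n : ℕ} {F : Type*} [Field F] (h2 : (2 : F) ≠ 0) (T : SLTM n F)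
    {r s : Fin n} {x y : F} (hx : x ≠ 0) (hy : y ≠ 0) (h : x • sgen T r = y • sgen T s) :
    r = s := by
  rcases lt_trichotomy r s with hrs | hrs | hrs
  · have := congrArg (coord T s) h
    rw [map_smul, map_smul, coord_sgen_self, coord_sgen_of_lt T hrs] at this
    simp [hy, h2] at this
  · exact hrs
  · have := congrArg (coord T r) h
    rw [map_smul, map_smul, coord_sgen_self, coord_sgen_of_lt T hrs] at this
    simp [hx, h2] at this

/-- Linear forms whose square lies in the square of an initial span, but which do not lie in this
span, are multiples of completed generators. -/
theorem exists_eq_smul_sgen {n : ℕ} {F : Type*} [Field F] (h2 : (2 : F) ≠ 0) {T : SLTM n F}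
    {m : ℕ} {a : Fin n → F} (hsq : lin T a * lin T a ∈ initial T m * initial T m)
    (ha : lin T a ∉ initial T m) :
    ∃ (r : Fin n) (x : F), m ≤ r ∧ x ≠ 0 ∧ lin T a = x • sgen T r := by
  classical
  rw [lin_mem_initial] at ha
  push Not at ha
  obtain ⟨i, hi, hai⟩ := ha
  -- The last nonzero coordinate r fixes the scalar a_r/2. For j < r the vanishing coefficient of
  -- X_j X_r reads 2a_j + a_r t_rj = 0, which determines all other coordinates.
  let s := Finset.univ.filter fun k : Fin n => a k ≠ 0
  have hs : s.Nonempty := ⟨i, by simp [s, hai]⟩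
  have hr : a (s.max' hs) ≠ 0 := (Finset.mem_filter.1 (s.max'_mem hs)).2
  have hle : ∀ k, a k ≠ 0 → k ≤ s.max' hs := fun k hk => s.le_max' k (by simp [s, hk])
  generalize s.max' hs = r at hr hle
  have hm : m ≤ r := hi.trans (hle i hai)
  refine ⟨r, a r / 2, hm, div_ne_zero hr h2, ?_⟩
  rw [sgen, ← map_smul]
  congr 1
  ext j
  rcases lt_trichotomy j r with hj | rfl | hj
  · have h := co_initial_mul h2 hj hm hsq
    rw [co_lin_mul_lin h2 T hj] at h
    have h' : a r * (2 * a j + a r * T.1 r j) = 0 := by linear_combination h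
    have h'' := (mul_eq_zero.1 h').resolve_left hr
    simp only [Pi.smul_apply, Pi.sub_apply, Pi.single_eq_of_ne hj.ne, smul_eq_mul]
    field_simp
    linear_combination h''
  · simp [T.2 j j le_rfl, h2]
  · have : a j = 0 := by
      by_contra h
      exact absurd (hle j h) (not_le.2 hj)
    simp [this, T.2 r j hj.le, hj.ne']

/-! ### The invariant filtration -/

/-- The isomorphism `e` identifies the spans of the first `m` generators. -/
def Compat {n : ℕ} {F : Type*} [Field F] {T S : SLTM n F} (e : Alg T ≃ₐ[F] Alg S) (m : ℕ) :
    Prop :=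
  (∀ x ∈ initial T m, e x ∈ initial S m) ∧ ∀ x ∈ initial S m, e.symm x ∈ initial T m

theorem Compat.symm {n : ℕ} {F : Type*} [Field F] {T S : SLTM n F} {e : Alg T ≃ₐ[F] Alg S}
    {m : ℕ} (h : Compat e m) : Compat e.symm m := ⟨h.2, h.1⟩

theorem compat_zero {n : ℕ} {F : Type*} [Field F] {T S : SLTM n F} (e : Alg T ≃ₐ[F] Alg S) :
    Compat e 0 := by
  have key : ∀ {T S : SLTM n F} (e : Alg T ≃ₐ[F] Alg S), ∀ x ∈ initial T 0, e x ∈ initial S 0 := by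
    intro T S e x hx
    obtain ⟨a, ha, rfl⟩ := exists_lin_of_mem_initial hx
    have : a = 0 := funext fun i => ha i (Nat.zero_le _)
    simp [this]
  exact ⟨key e, key e.symm⟩

theorem Compat.map_mul {n : ℕ} {F : Type*} [Field F] {T S : SLTM n F} {e : Alg T ≃ₐ[F] Alg S}
    {m : ℕ} (h : Compat e m) {x : Alg T} (hx : x ∈ initial T m * initial T m) :
    e x ∈ initial S m * initial S m := by
  refine Submodule.mul_induction_on hx ?_ ?_
  · intro y hy z hz
    rw [_root_.map_mul]
    exact Submodule.mul_mem_mul (h.1 y hy) (h.1 z hz)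
  · intro y z hy hz
    rw [map_add]
    exact add_mem hy hz

/-- The characterisation of completed generators by their squares mentions only the initial span,
which `e` respects. The image stays outside that span because `e.symm` respects it as well. -/
theorem Compat.exists_sgen {n : ℕ} {F : Type*} [Field F] (h2 : (2 : F) ≠ 0) {T S : SLTM n F}
    {e : Alg T ≃ₐ[F] Alg S} (he : IsGr e) {m : ℕ} (h : Compat e m) {r : Fin n} (hr : m ≤ r)
    (hsq : sgen T r * sgen T r ∈ initial T m * initial T m) :
    ∃ (s : Fin n) (x : F), m ≤ s ∧ x ≠ 0 ∧ e (sgen T r) = x • sgen S s ∧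
      sgen S s * sgen S s ∈ initial S m * initial S m := by
  obtain ⟨b, hb⟩ := he.exists_lin (Pi.single r 2 - T.1 r)
  have hb' : e (sgen T r) = lin S b := hb
  have h1 := h.map_mul hsq
  rw [_root_.map_mul, hb'] at h1
  have h3 : lin S b ∉ initial S m := fun hmem => by
    have := h.2 _ hmem
    rw [← hb', e.symm_apply_apply, sgen_mem_initial h2] at this
    omega
  obtain ⟨s, x, hs, hx, hsx⟩ := exists_eq_smul_sgen h2 h1 h3
  refine ⟨s, x, hs, hx, hb'.trans hsx, ?_⟩
  have h4 := Submodule.smul_mem _ (x⁻¹ * x⁻¹) h1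
  rw [hsx, smul_mul_smul_comm, smul_smul] at h4
  rwa [show x⁻¹ * x⁻¹ * (x * x) = 1 by field_simp, one_smul] at h4

/-- All nonzero entries of row `i` (counted from `0`) are among the first `c i` ones. -/
structure Bounded {n : ℕ} {F : Type*} [Field F] (T : SLTM n F) (c : Fin n → ℕ) : Prop where
  mono : Monotone c
  le : ∀ i, c i ≤ i
  zero : ∀ i j : Fin n, c i ≤ j → T.1 i j = 0

theorem Bounded.rowForm_mem {n : ℕ} {F : Type*} [Field F] {T : SLTM n F} {c : Fin n → ℕ}
    (hT : Bounded T c) {r : Fin n} {m : ℕ} (h : c r ≤ m) : rowForm T r ∈ initial T m :=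
  lin_mem_initial.2 fun j hj => hT.zero r j (h.trans hj)

theorem Bounded.sgen_sq_mem {n : ℕ} {F : Type*} [Field F] {T : SLTM n F} {c : Fin n → ℕ}
    (hT : Bounded T c) {r : Fin n} {m : ℕ} (h : c r ≤ m) :
    sgen T r * sgen T r ∈ initial T m * initial T m := by
  rw [sgen_mul_self]
  exact Submodule.mul_mem_mul (hT.rowForm_mem h) (hT.rowForm_mem h)

/-- No completed generator of a row with more than `m` entries has its square in the square of
the span of the first `m` generators. -/
def Detects {n : ℕ} {F : Type*} [Field F] (T : SLTM n F) (c : Fin n → ℕ) (m : ℕ) : Prop :=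
  ∀ r, sgen T r * sgen T r ∈ initial T m * initial T m → c r ≤ m

/-- With k = c i - 1 the leader of row i, the coefficient of X_j X_k in the square of the row form
is the product assumed nonzero. If c i > m then k ≥ m, and such a coefficient vanishes on the square
of the initial span. -/
theorem detects_of_irreducible {n : ℕ} {F : Type*} [Field F] (h2 : (2 : F) ≠ 0) {T : SLTM n F}
    {c : Fin n → ℕ}
    (h : ∀ i, c i ≠ 0 → ∃ j k : Fin n, j < k ∧ (k : ℕ) + 1 = c i ∧
      T.1 i k * (2 * T.1 i j + T.1 i k * T.1 k j) ≠ 0) (m : ℕ) : Detects T c m := by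
  intro r hr
  by_contra hc
  obtain ⟨j, k, hjk, hk, hne⟩ := h r (by omega)
  have := co_initial_mul h2 hjk (by omega) hr
  rw [sgen_mul_self, rowForm, co_lin_mul_lin h2 T hjk] at this
  exact hne (by linear_combination this)

theorem exists_sgen_of_le {n : ℕ} {F : Type*} [Field F] (h2 : (2 : F) ≠ 0) {T S : SLTM n F}
    {c d : Fin n → ℕ} (hT : Bounded T c) {m : ℕ} (hSm : Detects S d m) {e : Alg T ≃ₐ[F] Alg S}
    (he : IsGr e) (h : Compat e m) {r : Fin n} (hr : m ≤ r) (hc : c r ≤ m) :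
    ∃ (s : Fin n) (x : F), m ≤ s ∧ x ≠ 0 ∧ e (sgen T r) = x • sgen S s ∧ d s ≤ m := by
  obtain ⟨s, x, hs, hx, hsx, hsq⟩ := h.exists_sgen h2 he hr (hT.sgen_sq_mem hc)
  exact ⟨s, x, hs, hx, hsx, hSm s hsq⟩

theorem card_le_card_of_compat {n : ℕ} {F : Type*} [Field F] (h2 : (2 : F) ≠ 0) {T S : SLTM n F}
    {c d : Fin n → ℕ} (hT : Bounded T c) (hS : Bounded S d) {m : ℕ} (hSm : Detects S d m)
    {e : Alg T ≃ₐ[F] Alg S} (he : IsGr e) (h : Compat e m) :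
    (Finset.univ.filter fun r => c r ≤ m).card ≤ (Finset.univ.filter fun r => d r ≤ m).card := by
  have key : ∀ r : Fin n, ∃ s : Fin n, (m ≤ r → c r ≤ m →
      m ≤ s ∧ d s ≤ m ∧ ∃ x : F, x ≠ 0 ∧ e (sgen T r) = x • sgen S s) := by
    intro r
    by_cases hr : m ≤ r ∧ c r ≤ m
    · obtain ⟨s, x, hs, hx, hsx, hd⟩ := exists_sgen_of_le h2 hT hSm he h hr.1 hr.2
      exact ⟨s, fun _ _ => ⟨hs, hd, x, hx, hsx⟩⟩
    · exact ⟨r, fun h1 h2 => absurd ⟨h1, h2⟩ hr⟩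
  choose f hf using key
  -- Rows below m satisfy both length bounds automatically and are kept fixed. The remaining rows
  -- are sent to their partners, which have index at least m, so the two ranges do not meet.
  refine Finset.card_le_card_of_injOn (fun r => if m ≤ r then f r else r) ?_ ?_
  · intro r hr
    simp only [Finset.coe_filter, Finset.mem_univ, true_and, Set.mem_ofPred_eq] at hr ⊢
    split_ifs with hm
    · exact (hf r hm hr).2.1
    · have := hS.le r
      omega
  · intro r hr s hs hrs
    simp only [Finset.coe_filter, Finset.mem_univ, true_and, Set.mem_ofPred_eq] at hr hs hrs
    split_ifs at hrs with h1 h3 h3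
    · obtain ⟨-, -, x, hx, hxr⟩ := hf r h1 hr
      obtain ⟨-, -, y, hy, hys⟩ := hf s h3 hs
      rw [hrs] at hxr
      refine eq_of_smul_sgen_eq h2 T hy hx (e.injective ?_)
      rw [map_smul, map_smul, hxr, hys, smul_comm]
    · have := (hf r h1 hr).1
      rw [hrs] at this
      exact absurd this h3
    · have := (hf s h3 hs).1
      rw [← hrs] at this
      exact absurd this h1
    · exact hrs

/-- By monotonicity the rows of length at most m form an initial segment, which is determined by its
cardinality. -/
theorem Bounded.lt_card_iff {n : ℕ} {F : Type*} [Field F] {T : SLTM n F} {c : Fin n → ℕ}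
    (hT : Bounded T c) (m : ℕ) (j : Fin n) :
    (j : ℕ) < (Finset.univ.filter fun r => c r ≤ m).card ↔ c j ≤ m := by
  constructor
  · intro h
    by_contra hj
    have : (Finset.univ.filter fun r => c r ≤ m) ⊆ Finset.Iio j := by
      intro r hr
      rw [Finset.mem_filter] at hr
      rw [Finset.mem_Iio]
      by_contra hjr
      have := hT.mono (not_lt.1 hjr)
      omega
    have := Finset.card_le_card this
    rw [Fin.card_Iio] at this
    omega
  · intro h
    have : Finset.Iic j ⊆ Finset.univ.filter fun r => c r ≤ m := by
      intro r hr
      rw [Finset.mem_filter]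
      exact ⟨Finset.mem_univ _, (hT.mono (Finset.mem_Iic.1 hr)).trans h⟩
    have := Finset.card_le_card this
    rw [Fin.card_Iic] at this
    omega

/-- A generator X_i with m ≤ i and c i ≤ m is half of Z_i + R_i. Here Z_i goes to a multiple of a
completed generator of a short row, and R_i stays within the smaller span. -/
theorem map_initial_card {n : ℕ} {F : Type*} [Field F] (h2 : (2 : F) ≠ 0) {T S : SLTM n F}
    {c d : Fin n → ℕ} (hT : Bounded T c) (hS : Bounded S d) {m : ℕ}
    (hSm : Detects S d m) {e : Alg T ≃ₐ[F] Alg S} (he : IsGr e) (h : Compat e m) :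
    ∀ x ∈ initial T (Finset.univ.filter fun r => c r ≤ m).card,
      e x ∈ initial S (Finset.univ.filter fun r => d r ≤ m).card := by
  have hle : initial S m ≤ initial S (Finset.univ.filter fun r => d r ≤ m).card := by
    intro x hx
    obtain ⟨a, ha, rfl⟩ := exists_lin_of_mem_initial hx
    refine lin_mem_initial.2 fun i hi => ha i ?_
    by_contra hlt
    have := (hS.lt_card_iff m i).2 ((hS.le i).trans (by omega))
    omega
  have hgen : ∀ i : Fin n, (i : ℕ) < m → e (gen T i) ∈ initial S m := by
    intro i hi
    refine h.1 _ ?_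
    rw [← one_smul F (gen T i), ← lin_single]
    refine lin_mem_initial.2 fun k hk => Pi.single_eq_of_ne ?_ _
    rintro rfl
    omega
  intro x hx
  obtain ⟨a, ha, rfl⟩ := exists_lin_of_mem_initial hx
  rw [lin_apply, map_sum]
  refine Submodule.sum_mem _ fun i _ => ?_
  rw [map_smul]
  by_cases hi : (Finset.univ.filter fun r => c r ≤ m).card ≤ i
  · rw [ha i hi, zero_smul]
    exact Submodule.zero_mem _
  refine Submodule.smul_mem _ _ ?_
  by_cases him : (i : ℕ) < m
  · exact hle (hgen i him)
  have hci : c i ≤ m := (hT.lt_card_iff m i).1 (not_le.1 hi)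
  obtain ⟨s, y, -, -, hs, hds⟩ := exists_sgen_of_le h2 hT hSm he h (not_lt.1 him) hci
  have hg : (2 : F) • gen T i = sgen T i + rowForm T i := by rw [sgen_eq]; abel
  have : gen T i = (2 : F)⁻¹ • (sgen T i + rowForm T i) := by
    rw [← hg, inv_smul_smul₀ h2]
  rw [this, map_smul, map_add, hs]
  refine Submodule.smul_mem _ _ (Submodule.add_mem _ (Submodule.smul_mem _ _ ?_)
    (hle (h.1 _ (hT.rowForm_mem hci))))
  exact (sgen_mem_initial h2).2 ((hS.lt_card_iff m s).2 hds)

/-- The next step of the filtration. -/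
theorem Compat.next {n : ℕ} {F : Type*} [Field F] (h2 : (2 : F) ≠ 0) {T S : SLTM n F}
    {c d : Fin n → ℕ} (hT : Bounded T c) (hS : Bounded S d) {m : ℕ} (hTm : Detects T c m)
    (hSm : Detects S d m) {e : Alg T ≃ₐ[F] Alg S} (he : IsGr e) (h : Compat e m) :
    ∃ m', Compat e m' ∧ (∀ j : Fin n, (j : ℕ) < m' ↔ c j ≤ m) ∧
      ∀ j : Fin n, (j : ℕ) < m' ↔ d j ≤ m := by
  have hcard : (Finset.univ.filter fun r => c r ≤ m).card =
      (Finset.univ.filter fun r => d r ≤ m).card :=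
    le_antisymm (card_le_card_of_compat h2 hT hS hSm he h)
      (card_le_card_of_compat h2 hS hT hTm he.symm h.symm)
  refine ⟨(Finset.univ.filter fun r => c r ≤ m).card, ⟨?_, ?_⟩, hT.lt_card_iff m, ?_⟩
  · have := map_initial_card h2 hT hS hSm he h
    rwa [← hcard] at this
  · have := map_initial_card h2 hS hT hTm he.symm h.symm
    rwa [← hcard] at this
  · rw [hcard]
    exact hS.lt_card_iff m

/-! ### Rigidity of graded isomorphisms -/

/-- If an isomorphism permutes, up to scalars, the completed generators of a layer, then it
transports the products of the corresponding entries of later rows. -/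
theorem entries_mul_eq {n : ℕ} {F : Type*} [Field F] (h2 : (2 : F) ≠ 0) {T S : SLTM n F}
    {e : Alg T ≃ₐ[F] Alg S} (he : IsGr e) {p m : ℕ} (hp : Compat e p)
    (hT : ∀ j i : Fin n, (j : ℕ) < m → p ≤ i → T.1 j i = 0)
    (hS : ∀ j i : Fin n, (j : ℕ) < m → p ≤ i → S.1 j i = 0)
    {f : Fin n → Fin n} {y : Fin n → F}
    (hf : ∀ j : Fin n, p ≤ j → (j : ℕ) < m →
      p ≤ f j ∧ (f j : ℕ) < m ∧ y j ≠ 0 ∧ e (sgen T j) = y j • sgen S (f j))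
    {r s : Fin n} {x : F} (hx : e (sgen T r) = x • sgen S s)
    (hr : ∀ i : Fin n, m ≤ i → T.1 r i = 0) {j k : Fin n} (hjk : j ≠ k)
    (hpj : p ≤ j) (hjm : (j : ℕ) < m) (hpk : p ≤ k) (hkm : (k : ℕ) < m) :
    x ^ 2 * S.1 s (f j) * S.1 s (f k) = y j * y k * T.1 r j * T.1 r k := by
  have hinj : ∀ i k : Fin n, p ≤ i → (i : ℕ) < m → p ≤ k → (k : ℕ) < m → f i = f k → i = k := by
    intro i k hi hi' hk hk' h
    obtain ⟨-, -, hyi, hei⟩ := hf i hi hi'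
    obtain ⟨-, -, hyk, hek⟩ := hf k hk hk'
    refine eq_of_smul_sgen_eq h2 T hyk hyi (e.injective ?_)
    rw [map_smul, map_smul, hei, hek, h, smul_comm]
  -- In the coordinates of the layer [p, m), `e` acts on the generators like a monomial matrix: the
  -- row forms of these generators lie in the span of the first p and do not contribute.
  have hgen : ∀ i k : Fin n, (i : ℕ) < m → p ≤ k → (k : ℕ) < m →
      coord S (f k) (e (gen T i)) = if i = k then y k else 0 := by
    intro i k hi hk hk'
    by_cases hpi : (i : ℕ) < p
    · rw [if_neg (by rintro rfl; omega)]
      refine coord_initial (hp.1 _ ?_) (hf k hk hk').1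
      rw [← one_smul F (gen T i), ← lin_single]
      refine lin_mem_initial.2 fun l hl => Pi.single_eq_of_ne ?_ _
      rintro rfl
      omega
    · obtain ⟨hfi, hfi', hyi, hei⟩ := hf i (not_lt.1 hpi) hi
      have h0 : coord S (f k) (e (rowForm T i)) = 0 :=
        coord_initial (hp.1 _ (lin_mem_initial.2 fun l hl => hT i l hi hl)) (hf k hk hk').1
      have hg : (2 : F) • gen T i = sgen T i + rowForm T i := by rw [sgen_eq]; abel
      have h1 := congrArg (fun z => coord S (f k) (e z)) hg
      simp only [map_smul, map_add, h0, hei, add_zero, smul_eq_mul] at h1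
      split_ifs with hik
      · subst hik
        rw [coord_sgen_self] at h1
        exact mul_left_cancel₀ h2 (h1.trans (mul_comm _ _))
      · have hne : f k ≠ f i := fun h => hik (hinj k i hk hk' (not_lt.1 hpi) hi h).symm
        rw [coord_sgen_of_ne S hne, hS _ _ hfi' (hf k hk hk').1] at h1
        simpa [h2] using h1
  obtain ⟨b, hb⟩ := he.exists_lin (T.1 r)
  have hbk : ∀ k : Fin n, p ≤ k → (k : ℕ) < m → b (f k) = T.1 r k * y k := by
    intro k hk hk'
    rw [← coord_lin S (f k) b, ← hb, lin_apply, map_sum, map_sum,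
      Finset.sum_eq_single k]
    · rw [map_smul, map_smul, hgen k k hk' hk hk', if_pos rfl, smul_eq_mul]
    · intro i _ hik
      by_cases hi : (i : ℕ) < m
      · rw [map_smul, map_smul, hgen i k hi hk hk', if_neg hik, smul_zero]
      · rw [hr i (not_lt.1 hi), zero_smul, map_zero, map_zero]
    · simp
  have hsq : lin S b * lin S b = (x * x) • (lin S (S.1 s) * lin S (S.1 s)) := by
    have h := sgen_mul_self S s
    rw [rowForm] at h
    rw [← hb, ← h, ← smul_mul_smul_comm, ← hx, ← map_mul e, ← map_mul e, sgen_mul_self, rowForm]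
  -- Inside the layer the entry of S in row f k and column f j vanishes, so the coefficient formula
  -- loses its correction term and only the doubled product of the two coordinates is left.
  have key : ∀ j k : Fin n, p ≤ j → (j : ℕ) < m → p ≤ k → (k : ℕ) < m → f j < f k →
      x ^ 2 * S.1 s (f j) * S.1 s (f k) = y j * y k * T.1 r j * T.1 r k := by
    intro j k hj hj' hk hk' hlt
    have h := congrArg (co S (f j) (f k)) hsq
    rw [map_smul, co_lin_mul_lin h2 S hlt, co_lin_mul_lin h2 S hlt,
      hS _ _ (hf k hk hk').2.1 (hf j hj hj').1, hbk j hj hj', hbk k hk hk', smul_eq_mul] at h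
    refine mul_left_cancel₀ h2 ?_
    linear_combination -h
  rcases lt_trichotomy (f j) (f k) with h | h | h
  · exact key j k hpj hjm hpk hkm h
  · exact absurd (hinj j k hpj hjm hpk hkm h) hjk
  · linear_combination key k j hpk hkm hpj hjm h

theorem card_filter_fin_between {n p q : ℕ} (hq : q ≤ n) :
    (Finset.univ.filter fun j : Fin n => p ≤ j ∧ (j : ℕ) < q).card = q - p := by
  rw [← Nat.card_Ico, ← Finset.card_map Fin.valEmbedding]
  congr 1
  ext i
  simp only [Finset.mem_map, Finset.mem_filter, Finset.mem_univ, true_and,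
    Fin.valEmbedding_apply, Finset.mem_Ico]
  constructor
  · rintro ⟨j, hj, rfl⟩
    exact hj
  · exact fun h => ⟨⟨i, h.2.trans_le hq⟩, h, rfl⟩

/-- The entries of row `i` (counted from `0`) are nonzero exactly at the first `c i` places. -/
structure Full {n : ℕ} {F : Type*} [Field F] (T : SLTM n F) (c : Fin n → ℕ) : Prop
    extends Bounded T c where
  ne_zero : ∀ i j : Fin n, (j : ℕ) < c i → T.1 i j ≠ 0

/-- The isomorphism `e` matches the completed generators of the first `m` rows with completed
generators of rows of the same length. -/
def Matches {n : ℕ} {F : Type*} [Field F] {T S : SLTM n F} (c d : Fin n → ℕ)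
    (e : Alg T ≃ₐ[F] Alg S) (m : ℕ) : Prop :=
  ∀ r : Fin n, (r : ℕ) < m → ∃ (s : Fin n) (x : F), x ≠ 0 ∧ e (sgen T r) = x • sgen S s ∧ c r = d s

/-- The columns from p up to the end of row r are mapped injectively by `f` into those of row s:
nonzero products of two entries remain nonzero, and a nonzero entry of S lies within its row length.
-/
theorem length_le_of_layer {n : ℕ} {F : Type*} [Field F] (h2 : (2 : F) ≠ 0) {T S : SLTM n F}
    {c d : Fin n → ℕ} (hT : Full T c) (hS : Full S d)
    {e : Alg T ≃ₐ[F] Alg S} (he : IsGr e) {p m : ℕ} (hp : Compat e p)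
    (hcm : ∀ j : Fin n, (j : ℕ) < m ↔ c j ≤ p) (hdm : ∀ j : Fin n, (j : ℕ) < m ↔ d j ≤ p)
    (hM : Matches c d e m) {r s : Fin n} {x : F} (hx : e (sgen T r) = x • sgen S s)
    (hr : c r ≤ m) (hs : p < d s) : c r ≤ d s := by
  -- Only products of two distinct entries are transported, so each column needs a companion in the
  -- layer. With at most one column beyond p there is none, but then the claim follows from p < d s.
  by_cases hcr : c r ≤ p + 1
  · omega
  have key : ∀ j : Fin n, ∃ (i : Fin n) (z : F), p ≤ j → (j : ℕ) < m →
      p ≤ i ∧ (i : ℕ) < m ∧ z ≠ 0 ∧ e (sgen T j) = z • sgen S i := by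
    intro j
    by_cases hj : p ≤ j ∧ (j : ℕ) < m
    · obtain ⟨i, z, hz, hi, hci⟩ := hM j hj.2
      refine ⟨i, z, fun _ _ => ⟨?_, ?_, hz, hi⟩⟩
      · by_contra hlt
        have h3 := hp.2 _ (Submodule.smul_mem _ z ((sgen_mem_initial h2).2 (not_le.1 hlt)))
        rw [← hi, e.symm_apply_apply, sgen_mem_initial h2] at h3
        omega
      · rw [hdm, ← hci, ← hcm]
        exact hj.2
    · exact ⟨j, 0, fun h h' => absurd ⟨h, h'⟩ hj⟩
  choose f y hf using key
  have hcn : c r ≤ n := (hT.le r).trans r.2.le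
  have hdn : d s ≤ n := (hS.le s).trans s.2.le
  have hsub : c r - p ≤ d s - p := by
    rw [← card_filter_fin_between hcn, ← card_filter_fin_between hdn]
    refine Finset.card_le_card_of_injOn f ?_ ?_
    · intro j hj
      simp only [Finset.coe_filter, Finset.mem_univ, true_and, Set.mem_ofPred_eq] at hj ⊢
      refine ⟨(hf j hj.1 (hj.2.trans_le hr)).1, ?_⟩
      obtain ⟨k, hkj, hpk, hk⟩ : ∃ k : Fin n, k ≠ j ∧ p ≤ k ∧ (k : ℕ) < c r := by
        by_cases hjp : (j : ℕ) = p
        · exact ⟨⟨p + 1, by omega⟩, fun h => by simp [Fin.ext_iff] at h; omega, by simp,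
            by simp; omega⟩
        · exact ⟨⟨p, by omega⟩, fun h => by simp [Fin.ext_iff] at h; omega, by simp,
            by simp; omega⟩
      have h := entries_mul_eq h2 he hp
        (fun j i hj hi => hT.zero j i (((hcm j).1 hj).trans hi))
        (fun j i hj hi => hS.zero j i (((hdm j).1 hj).trans hi)) hf hx
        (fun i hi => hT.zero r i (hr.trans hi)) hkj hpk (hk.trans_le hr) hj.1 (hj.2.trans_le hr)
      by_contra hlt
      rw [hS.zero s _ (not_lt.1 hlt), mul_zero] at h
      have hyk := (hf k hpk (hk.trans_le hr)).2.2.1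
      have hyj := (hf j hj.1 (hj.2.trans_le hr)).2.2.1
      exact mul_ne_zero (mul_ne_zero (mul_ne_zero hyk hyj) (hT.ne_zero r k hk))
        (hT.ne_zero r j hj.2) h.symm
    · intro i hi j hj hij
      simp only [Finset.coe_filter, Finset.mem_univ, true_and, Set.mem_ofPred_eq] at hi hj
      obtain ⟨-, -, hyi, hei⟩ := hf i hi.1 (hi.2.trans_le hr)
      obtain ⟨-, -, hyj, hej⟩ := hf j hj.1 (hj.2.trans_le hr)
      refine eq_of_smul_sgen_eq h2 T hyj hyi (e.injective ?_)
      rw [map_smul, map_smul, hei, hej, hij, smul_comm]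
  omega

/-- Rows in the new layer have length in (p, m], and so do their partners. The layer comparison
applied to `e` and to its inverse gives both inequalities between the lengths. -/
theorem Matches.next {n : ℕ} {F : Type*} [Field F] (h2 : (2 : F) ≠ 0) {T S : SLTM n F}
    {c d : Fin n → ℕ} (hT : Full T c) (hS : Full S d) (hSd : ∀ m, Detects S d m)
    {e : Alg T ≃ₐ[F] Alg S} (he : IsGr e) {p m m' : ℕ}
    (hp : Compat e p) (hm : Compat e m)
    (hcm : ∀ j : Fin n, (j : ℕ) < m ↔ c j ≤ p) (hdm : ∀ j : Fin n, (j : ℕ) < m ↔ d j ≤ p)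
    (hcm' : ∀ j : Fin n, (j : ℕ) < m' ↔ c j ≤ m) (hM : Matches c d e m)
    (hM' : Matches d c e.symm m) : Matches c d e m' := by
  intro r hr
  by_cases hrm : (r : ℕ) < m
  · exact hM r hrm
  have hcr := (hcm' r).1 hr
  obtain ⟨s, x, hs, hx, hsx, hds⟩ := exists_sgen_of_le h2 hT.toBounded (hSd m) he hm
    (not_lt.1 hrm) hcr
  have hps : p < d s := by
    by_contra h
    have := (hdm s).2 (not_lt.1 h)
    omega
  have hpr : p < c r := by
    by_contra h
    exact hrm ((hcm r).2 (not_lt.1 h))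
  refine ⟨s, x, hx, hsx, le_antisymm
    (length_le_of_layer h2 hT hS he hp hcm hdm hM hsx hcr hps)
    (length_le_of_layer (x := x⁻¹) h2 hS hT he.symm hp.symm hdm hcm hM' ?_ hds hpr)⟩
  rw [AlgEquiv.symm_apply_eq, map_smul, hsx, inv_smul_smul₀ hx]

theorem Matches.zero {n : ℕ} {F : Type*} [Field F] (h2 : (2 : F) ≠ 0) {T S : SLTM n F}
    {c d : Fin n → ℕ} (hT : Bounded T c) (hSd : Detects S d 0)
    {e : Alg T ≃ₐ[F] Alg S} (he : IsGr e) {m : ℕ}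
    (hcm : ∀ j : Fin n, (j : ℕ) < m ↔ c j ≤ 0) : Matches c d e m := by
  intro r hr
  have hcr := (hcm r).1 hr
  obtain ⟨s, x, hs, hx, hsx, hds⟩ := exists_sgen_of_le h2 hT hSd he (compat_zero e)
    (Nat.zero_le _) hcr
  exact ⟨s, x, hx, hsx, by omega⟩

/-- The equivalence class determines the row lengths of full matrices. -/
theorem Full.eq_of_sim {n : ℕ} {F : Type*} [Field F] (h2 : (2 : F) ≠ 0) {T S : SLTM n F}
    {c d : Fin n → ℕ} (hT : Full T c) (hS : Full S d) (hTd : ∀ m, Detects T c m)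
    (hSd : ∀ m, Detects S d m) (h : Sim T S) : c = d := by
  obtain ⟨e, he⟩ := h
  change IsGr e at he
  have step : ∀ k, k ≤ n → ∃ p m, k ≤ m ∧ Compat e p ∧ Compat e m ∧
      (∀ j : Fin n, (j : ℕ) < m ↔ c j ≤ p) ∧ (∀ j : Fin n, (j : ℕ) < m ↔ d j ≤ p) ∧
      Matches c d e m ∧ Matches d c e.symm m := by
    intro k
    induction k with
    | zero =>
      intro _
      obtain ⟨m, hm, hcm, hdm⟩ := (compat_zero e).next h2 hT.toBounded hS.toBounded (hTd 0)
        (hSd 0) he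
      exact ⟨0, m, Nat.zero_le _, compat_zero e, hm, hcm, hdm,
        Matches.zero h2 hT.toBounded (hSd 0) he hcm,
        Matches.zero h2 hS.toBounded (hTd 0) he.symm hdm⟩
    | succ k ih =>
      intro hk
      obtain ⟨p, m, hkm, hp, hm, hcm, hdm, hM, hM'⟩ := ih (by omega)
      obtain ⟨m', hm', hcm', hdm'⟩ := hm.next h2 hT.toBounded hS.toBounded (hTd m) (hSd m) he
      refine ⟨m, m', ?_, hm, hm', hcm', hdm', hM.next h2 hT hS hSd he hp hm hcm hdm hcm' hM',
        hM'.next h2 hS hT hTd he.symm hp.symm hm.symm hdm hcm hdm' hM⟩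
      -- Row k has length at most k ≤ m, hence belongs to the next layer. This makes the filtration
      -- exhaust all rows after finitely many steps.
      have := (hcm' ⟨k, hk⟩).2 ((hT.le _).trans hkm)
      exact this
  obtain ⟨p, m, hnm, -, -, -, -, hM, -⟩ := step n le_rfl
  choose f x hx hf hcf using fun r : Fin n => hM r (r.2.trans_le hnm)
  have hinj : Function.Injective f := by
    intro i j hij
    refine eq_of_smul_sgen_eq h2 T (hx j) (hx i) (e.injective ?_)
    rw [map_smul, map_smul, hf i, hf j, hij, smul_comm]
  let σ : Equiv.Perm (Fin n) := Equiv.ofBijective f (Finite.injective_iff_bijective.1 hinj)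
  have hσ : d ∘ σ = c := funext fun r => (hcf r).symm
  -- The lengths agree up to a permutation; two monotone rearrangements of one sequence coincide.
  have := Tuple.unique_monotone (f := d) (σ := σ) (τ := Equiv.refl _) (by rw [hσ]; exact hT.mono)
    hS.mono
  rw [hσ] at this
  exact this

/-! ### Staircase matrices and the two exceptional matrices -/

/-- The matrix whose row `i` (counted from `0`) is `(1, …, 1, μ, 0, …, 0)` with `c i` nonzero
entries. -/
def stair (n : ℕ) {F : Type*} [Field F] (μ : F) (c : Fin n → ℕ) (hc : ∀ i, c i ≤ i) : SLTM n F :=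
  ⟨Matrix.of fun i j => if (j : ℕ) + 1 < c i then 1 else if (j : ℕ) + 1 = c i then μ else 0, by
    intro i j hij
    have := hc i
    have : (i : ℕ) ≤ j := hij
    rw [Matrix.of_apply, if_neg (by omega), if_neg (by omega)]⟩

theorem stair_apply (n : ℕ) {F : Type*} [Field F] (μ : F) (c : Fin n → ℕ) (hc : ∀ i, c i ≤ i)
    (i j : Fin n) : (stair n μ c hc).1 i j =
      if (j : ℕ) + 1 < c i then 1 else if (j : ℕ) + 1 = c i then μ else 0 := rfl

theorem stair_full {n : ℕ} {F : Type*} [Field F] {μ : F} (hμ : μ ≠ 0) {c : Fin n → ℕ}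
    (hc : ∀ i, c i ≤ i) (hmono : Monotone c) : Full (stair n μ c hc) c where
  mono := hmono
  le := hc
  zero i j h := by rw [stair_apply, if_neg (by omega), if_neg (by omega)]
  ne_zero i j h := by
    rw [stair_apply]
    split_ifs
    · exact one_ne_zero
    · exact hμ
    · omega

/-- Row 1 is zero because its length is at most 1 and not 1. Hence X_0 X_1 has coefficient 2 t_r0
t_r1 in the square of a nonzero row form. Only the level m = 0 is covered, but this needs no
irreducible leaders and so applies to `Psi` in characteristic 3 too. -/
theorem Full.detects_zero {n : ℕ} {F : Type*} [Field F] (h2 : (2 : F) ≠ 0) {T : SLTM n F}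
    {c : Fin n → ℕ} (hT : Full T c) (h1 : ∀ i, c i ≠ 1) : Detects T c 0 := by
  intro r hr
  by_contra hc
  have hc1 := h1 r
  have hcr := hT.le r
  have hrn := r.2
  have hlt : (⟨0, by omega⟩ : Fin n) < ⟨1, by omega⟩ := by simp
  have h := co_initial_mul h2 hlt (Nat.zero_le _) hr
  have h10 : T.1 ⟨1, by omega⟩ ⟨0, by omega⟩ = 0 := hT.zero _ _ (by
    have := hT.le ⟨1, by omega⟩
    have := h1 ⟨1, by omega⟩
    simp only at *
    omega)
  rw [sgen_mul_self, rowForm, co_lin_mul_lin h2 T hlt, h10] at h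
  have h0 := hT.ne_zero r ⟨0, by omega⟩ (by simp; omega)
  have h1 := hT.ne_zero r ⟨1, by omega⟩ (by simp; omega)
  exact mul_ne_zero h2 (mul_ne_zero h0 h1) (by linear_combination h)

/-- Testing the leader against column 0 gives 2 - t with t the first entry of the leader's row. As
length 1 is excluded, t is 0 or 1 and never -1, so 2 - t is 2 or 1. With final entry 1 the value 2 +
t could be 3. -/
theorem stair_neg_one_detects {n : ℕ} {F : Type*} [Field F] (h2 : (2 : F) ≠ 0) {c : Fin n → ℕ}
    (hc : ∀ i, c i ≤ i) (h1 : ∀ i, c i ≠ 1) (m : ℕ) :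
    Detects (stair n (-1 : F) c hc) c m := by
  refine detects_of_irreducible h2 (fun i hi => ?_) m
  have hi1 := h1 i
  have hin := i.2
  have hci := hc i
  refine ⟨⟨0, by omega⟩, ⟨c i - 1, by omega⟩, ?_, ?_, ?_⟩
  · rw [Fin.lt_def]
    simp only
    omega
  · simp only
    omega
  · have hk := h1 ⟨c i - 1, by omega⟩
    rw [stair_apply, stair_apply, stair_apply]
    simp only
    rw [if_neg (by omega), if_pos (by omega), if_pos (by omega)]
    split_ifs with h h'
    · intro h3
      apply one_ne_zero (α := F)
      linear_combination -h3
    · omega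
    · intro h3
      apply h2
      linear_combination -h3

theorem stair_neg_one_injective {n : ℕ} {F : Type*} [Field F] (h2 : (2 : F) ≠ 0)
    {c d : Fin n → ℕ} (hc : ∀ i, c i ≤ i) (hd : ∀ i, d i ≤ i) (hcm : Monotone c)
    (hdm : Monotone d) (hc1 : ∀ i, c i ≠ 1) (hd1 : ∀ i, d i ≠ 1)
    (h : Sim (stair n (-1 : F) c hc) (stair n (-1 : F) d hd)) : c = d :=
  (stair_full (neg_ne_zero.2 one_ne_zero) hc hcm).eq_of_sim h2
    (stair_full (neg_ne_zero.2 one_ne_zero) hd hdm) (stair_neg_one_detects h2 hc hc1)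
    (stair_neg_one_detects h2 hd hd1) h

/-! ### The exceptional matrix for `n ≥ 5` -/

/-- The row lengths of `extra`. -/
def extraLength (n : ℕ) (i : Fin n) : ℕ :=
  if (i : ℕ) < 3 then 0 else if (i : ℕ) + 1 < n then 2 else 3

theorem extra_apply (n : ℕ) (F : Type*) [Field F] (i j : Fin n) :
    (extra n F).1 i j = if j < i then
      if (4 ≤ (i : ℕ) + 1 ∧ (i : ℕ) + 1 < n ∧ ((j : ℕ) + 1 = 1 ∨ (j : ℕ) + 1 = 2)) ∨
        ((i : ℕ) + 1 = n ∧ ((j : ℕ) + 1 = 1 ∨ (j : ℕ) + 1 = 3)) then 1 else 0 else 0 := rfl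

theorem extra_eq_one {n : ℕ} (F : Type*) [Field F] (hn : 5 ≤ n) {i j : Fin n}
    (h : (3 ≤ (i : ℕ) ∧ (i : ℕ) + 1 < n ∧ (j : ℕ) < 2) ∨
      ((i : ℕ) + 1 = n ∧ ((j : ℕ) = 0 ∨ (j : ℕ) = 2))) : (extra n F).1 i j = 1 := by
  rw [extra_apply, if_pos (by rw [Fin.lt_def]; omega), if_pos (by omega)]

theorem extra_eq_zero {n : ℕ} (F : Type*) [Field F] {i j : Fin n}
    (h : ¬ ((3 ≤ (i : ℕ) ∧ (i : ℕ) + 1 < n ∧ (j : ℕ) < 2) ∨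
      ((i : ℕ) + 1 = n ∧ ((j : ℕ) = 0 ∨ (j : ℕ) = 2)))) : (extra n F).1 i j = 0 := by
  rw [extra_apply]
  split_ifs
  · omega
  · rfl
  · rfl

theorem extra_bounded {n : ℕ} (F : Type*) [Field F] (hn : 5 ≤ n) :
    Bounded (extra n F) (extraLength n) where
  mono i j hij := by
    have : (i : ℕ) ≤ j := hij
    have := j.2
    unfold extraLength
    split_ifs <;> omega
  le i := by
    unfold extraLength
    split_ifs <;> omega
  zero i j h := by
    refine extra_eq_zero F ?_
    unfold extraLength at h
    have := i.2
    split_ifs at h <;> omega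

theorem extra_detects {n : ℕ} {F : Type*} [Field F] (h2 : (2 : F) ≠ 0) (hn : 5 ≤ n) (m : ℕ) :
    Detects (extra n F) (extraLength n) m := by
  refine detects_of_irreducible h2 (fun i hi => ?_) m
  have hin := i.2
  unfold extraLength at hi ⊢
  split_ifs at hi ⊢ with h3 hlast
  · omega
  · refine ⟨⟨0, by omega⟩, ⟨1, by omega⟩, by simp, rfl, ?_⟩
    rw [extra_eq_one F hn (i := i) (by simp; omega), extra_eq_one F hn (i := i) (by simp; omega),
      extra_eq_zero F (by simp; omega)]
    simpa using h2
  · refine ⟨⟨0, by omega⟩, ⟨2, by omega⟩, by simp, rfl, ?_⟩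
    rw [extra_eq_one F hn (i := i) (by simp; omega), extra_eq_one F hn (i := i) (by simp; omega),
      extra_eq_zero F (by simp; omega)]
    simpa using h2

/-- The first layer consists of the indices 0, 1, 2, which the isomorphism permutes through `f`.
Supports in S are initial segments, so the column missed by a row of support size two must go to
index 2. The supports {0,1} and {0,2} miss different columns, contradicting injectivity. -/
theorem not_sim_extra_full {n : ℕ} {F : Type*} [Field F] (h2 : (2 : F) ≠ 0) (hn : 5 ≤ n)
    {S : SLTM n F} {d : Fin n → ℕ} (hS : Full S d) (hd1 : ∀ i, d i ≠ 1) :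
    ¬ Sim (extra n F) S := by
  rintro ⟨e, he⟩
  change IsGr e at he
  have hT := extra_bounded F hn
  have hSd := hS.detects_zero h2 hd1
  obtain ⟨m, hm, hcm, hdm⟩ := (compat_zero e).next h2 hT hS.toBounded (extra_detects h2 hn 0)
    hSd he
  obtain rfl : m = 3 := by
    have h3 : 2 < m := (hcm ⟨2, by omega⟩).2 (by simp [extraLength])
    have h4 : ¬ 3 < m := fun h => by
      have := (hcm ⟨3, by omega⟩).1 h
      unfold extraLength at this
      split_ifs at this
      · simp at *
      · omega
      · omega
    omega
  have key : ∀ j : Fin n, ∃ (i : Fin n) (z : F), 0 ≤ (j : ℕ) → (j : ℕ) < 3 →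
      0 ≤ (i : ℕ) ∧ (i : ℕ) < 3 ∧ z ≠ 0 ∧ e (sgen (extra n F) j) = z • sgen S i := by
    intro j
    by_cases hj : (j : ℕ) < 3
    · obtain ⟨i, z, -, hz, hi, hdi⟩ := exists_sgen_of_le h2 hT hSd he (compat_zero e)
        (Nat.zero_le j) ((hcm j).1 hj)
      exact ⟨i, z, fun _ _ => ⟨Nat.zero_le _, (hdm i).2 hdi, hz, hi⟩⟩
    · exact ⟨j, 0, fun _ h' => absurd h' hj⟩
  choose f y hf using key
  -- Column 0 is nonzero in every row considered and serves as common factor: the product with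
  -- column j shows that the entry at f 0 is nonzero, the product with k that the entry at f k
  -- vanishes. Since d s ≥ 2, this forces f k = 2.
  have main : ∀ r j k : Fin n, 3 ≤ (r : ℕ) → 0 < (j : ℕ) → (j : ℕ) < 3 → 0 < (k : ℕ) →
      (k : ℕ) < 3 → (extra n F).1 r j = 1 → (extra n F).1 r k = 0 → (f k : ℕ) = 2 := by
    intro r j k hr hj0 hj hk0 hk hrj hrk
    have hcr : extraLength n r ≤ 3 := by
      unfold extraLength
      split_ifs <;> omega
    obtain ⟨s, x, hs, hx, hsx, -⟩ := hm.exists_sgen h2 he hr (hT.sgen_sq_mem hcr)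
    have hent : ∀ k : Fin n, 0 < (k : ℕ) → (k : ℕ) < 3 → x ^ 2 * S.1 s (f ⟨0, by omega⟩) *
        S.1 s (f k) = y ⟨0, by omega⟩ * y k * (extra n F).1 r ⟨0, by omega⟩ *
          (extra n F).1 r k := fun k hk0 hk =>
      entries_mul_eq h2 he (compat_zero e)
        (fun j i hj hi => hT.zero j i (((hcm j).1 hj).trans hi))
        (fun j i hj hi => hS.zero j i (((hdm j).1 hj).trans hi)) hf hsx
        (fun i hi => hT.zero r i (hcr.trans hi)) (by rw [Ne, Fin.ext_iff]; simp; omega)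
        (Nat.zero_le _) (by simp) (Nat.zero_le _) hk
    have h1 := hent j hj0 hj
    have h3 := hent k hk0 hk
    have hrn := r.2
    rw [extra_eq_one F hn (by simp; omega), hrj, mul_one, mul_one] at h1
    rw [hrk, mul_zero] at h3
    have h0 : S.1 s (f ⟨0, by omega⟩) ≠ 0 := by
      intro h
      rw [h, mul_zero, zero_mul] at h1
      exact mul_ne_zero (hf ⟨0, by omega⟩ (Nat.zero_le _) (by simp)).2.2.1
        (hf j (Nat.zero_le _) hj).2.2.1 h1.symm
    have hk' := (mul_eq_zero.1 h3).resolve_left (mul_ne_zero (pow_ne_zero 2 hx) h0)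
    have hle : d s ≤ f k := by
      by_contra h
      exact hS.ne_zero s _ (not_le.1 h) hk'
    have hds : ¬ d s ≤ 0 := fun h => absurd ((hdm s).2 h) (not_lt.2 hs)
    have hd1s := hd1 s
    have := (hf k (Nat.zero_le _) hk).2.1
    omega
  have hf2 := main ⟨3, by omega⟩ ⟨1, by omega⟩ ⟨2, by omega⟩ (by simp) (by simp) (by simp)
    (by simp) (by simp) (extra_eq_one F hn (by simp; omega)) (extra_eq_zero F (by simp; omega))
  have hf1 := main ⟨n - 1, by omega⟩ ⟨2, by omega⟩ ⟨1, by omega⟩ (by simp; omega) (by simp)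
    (by simp) (by simp) (by simp) (extra_eq_one F hn (by simp; omega))
    (extra_eq_zero F (by simp; omega))
  obtain ⟨-, -, hy1, he1⟩ := hf ⟨1, by omega⟩ (Nat.zero_le _) (by simp)
  obtain ⟨-, -, hy2, he2⟩ := hf ⟨2, by omega⟩ (Nat.zero_le _) (by simp)
  have hff : f ⟨1, by omega⟩ = f ⟨2, by omega⟩ := Fin.ext (hf1.trans hf2.symm)
  have := eq_of_smul_sgen_eq h2 (extra n F) (r := ⟨1, by omega⟩) (s := ⟨2, by omega⟩) hy2 hy1
    (e.injective (by
    rw [map_smul, map_smul, he1, he2, hff, smul_comm]))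
  simp at this

theorem not_sim_zero_of_detects {n : ℕ} {F : Type*} [Field F] (h2 : (2 : F) ≠ 0)
    {T : SLTM n F} {c : Fin n → ℕ} (hT : Bounded T c) (hTd : Detects T c 0) {i : Fin n}
    (hi : c i ≠ 0) : ¬ Sim T ⟨0, fun _ _ _ => rfl⟩ := by
  rintro ⟨e, he⟩
  obtain ⟨m, -, hcm, hdm⟩ := (compat_zero e).next (d := fun _ => 0) h2 hT
    ⟨fun _ _ _ => le_rfl, fun _ => Nat.zero_le _, fun _ _ _ => rfl⟩ hTd (fun _ _ => le_rfl) he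
  have := (hcm i).1 ((hdm i).2 le_rfl)
  omega

/-! ### The `4 × 4` matrices -/

/-- A substitution by linear forms that is compatible with the relations and has an inverse of
the same kind gives an equivalence. -/
theorem sim_of_substitution {n : ℕ} {F : Type*} [Field F] {T S : SLTM n F}
    (a b : Fin n → Fin n → F)
    (ha : ∀ i, lin S (a i) * lin S (a i) = (∑ j, T.1 i j • lin S (a j)) * lin S (a i))
    (hb : ∀ i, lin T (b i) * lin T (b i) = (∑ j, S.1 i j • lin T (b j)) * lin T (b i))
    (hab : ∀ i, ∑ j, a i j • lin T (b j) = gen T i)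
    (hba : ∀ i, ∑ j, b i j • lin S (a j) = gen S i) : Sim T S := by
  have hgr : ∀ {T S : SLTM n F} (a : Fin n → Fin n → F)
      (ha : ∀ i, lin S (a i) * lin S (a i) = (∑ j, T.1 i j • lin S (a j)) * lin S (a i)) (d : ℕ)
      (x : Alg T), x ∈ gradedPiece T d → liftAlg T _ ha x ∈ gradedPiece S d := by
    rintro T S a ha d _ ⟨p, hp, rfl⟩
    -- The map lifts to a substitution of linear forms in the polynomial ring, where preservation of
    -- weighted homogeneity can be checked on monomials.
    refine ⟨MvPolynomial.aeval (fun i => ∑ j, MvPolynomial.C (a i j) * MvPolynomial.X j) p, ?_, ?_⟩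
    · have hp' : p.IsWeightedHomogeneous (fun _ : Fin n => 2) d := hp
      show MvPolynomial.aeval _ p ∈ MvPolynomial.weightedHomogeneousSubmodule F _ d
      rw [p.as_sum, map_sum]
      refine Submodule.sum_mem _ fun m hm => ?_
      rw [MvPolynomial.aeval_monomial]
      have hw := hp' (MvPolynomial.mem_support_iff.1 hm)
      have h1 := MvPolynomial.IsWeightedHomogeneous.prod m.support
        (fun i => (∑ j, MvPolynomial.C (a i j) * MvPolynomial.X j : MvPolynomial (Fin n) F) ^ m i)
        (fun i => m i • 2) (w := fun _ : Fin n => 2) (fun i _ => by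
          refine MvPolynomial.IsWeightedHomogeneous.pow ?_ _
          refine Submodule.sum_mem (MvPolynomial.weightedHomogeneousSubmodule F _ 2) fun j _ => ?_
          rw [← MvPolynomial.smul_eq_C_mul]
          exact Submodule.smul_mem _ _ (MvPolynomial.isWeightedHomogeneous_X F _ j))
      have h2 : ∑ i ∈ m.support, m i • 2 = d := by
        rw [← hw, Finsupp.weight_apply, Finsupp.sum]
      rw [h2] at h1
      rw [MvPolynomial.algebraMap_eq, ← MvPolynomial.smul_eq_C_mul]
      exact Submodule.smul_mem _ _ h1
    · have : (Ideal.Quotient.mkₐ F (relIdeal S)).comp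
          (MvPolynomial.aeval fun i => ∑ j, MvPolynomial.C (a i j) * MvPolynomial.X j) =
          (liftAlg T _ ha).comp (Ideal.Quotient.mkₐ F (relIdeal T)) := by
        refine MvPolynomial.algHom_ext fun i => ?_
        rw [AlgHom.comp_apply, AlgHom.comp_apply, MvPolynomial.aeval_X, map_sum]
        refine Eq.trans ?_ (liftAlg_gen T _ ha i).symm
        rw [lin_apply]
        refine Finset.sum_congr rfl fun j _ => ?_
        rw [← MvPolynomial.smul_eq_C_mul, map_smul]
        rfl
      exact DFunLike.congr_fun this p
  have hcomp : ∀ {T S : SLTM n F} (a b : Fin n → Fin n → F)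
      (ha : ∀ i, lin S (a i) * lin S (a i) = (∑ j, T.1 i j • lin S (a j)) * lin S (a i))
      (hb : ∀ i, lin T (b i) * lin T (b i) = (∑ j, S.1 i j • lin T (b j)) * lin T (b i)),
      (∀ i, ∑ j, a i j • lin T (b j) = gen T i) →
      (liftAlg S _ hb).comp (liftAlg T _ ha) = AlgHom.id F (Alg T) := by
    intro T S a b ha hb hab
    refine Ideal.Quotient.algHom_ext F ?_
    refine MvPolynomial.algHom_ext fun i => ?_
    change liftAlg S _ hb (liftAlg T _ ha (gen T i)) = gen T i
    rw [liftAlg_gen, liftAlg_lin, hab]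
  refine ⟨AlgEquiv.ofAlgHom (liftAlg T _ ha) (liftAlg S _ hb) (hcomp b a hb ha hba)
    (hcomp a b ha hb hab), fun d x => ⟨hgr a ha d x, fun hx => ?_⟩⟩
  have h := hgr b hb d _ hx
  have h' : liftAlg S _ hb (liftAlg T _ ha x) = x :=
    DFunLike.congr_fun (hcomp a b ha hb hab) x
  change liftAlg S _ hb (liftAlg T _ ha x) ∈ _ at h
  rwa [h'] at h

theorem smul_eq_algebraMap_mul {n : ℕ} {F : Type*} [Field F] {T : SLTM n F} (x : F) (y : Alg T) :
    x • y = algebraMap F (Alg T) x * y := Algebra.smul_def x y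

theorem lin_four {F : Type*} [Field F] (T : SLTM 4 F) (a b c d : F) :
    lin T ![a, b, c, d] = a • gen T 0 + b • gen T 1 + c • gen T 2 + d • gen T 3 := by
  simp [lin_apply, Fin.sum_univ_four]

theorem forall_fin_four {P : Fin 4 → Prop} (h0 : P 0) (h1 : P 1) (h2 : P 2) (h3 : P 3) (i : Fin 4) :
    P i := by
  fin_cases i <;> assumption

theorem fourMat_row_zero {F : Type*} [Field F] (u v : F) : (fourMat F u v).1 0 = ![0, 0, 0, 0] :=
  rfl

theorem fourMat_row_one {F : Type*} [Field F] (u v : F) : (fourMat F u v).1 1 = ![0, 0, 0, 0] :=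
  rfl

theorem fourMat_row_two {F : Type*} [Field F] (u v : F) : (fourMat F u v).1 2 = ![1, 1, 0, 0] :=
  rfl

theorem fourMat_row_three {F : Type*} [Field F] (u v : F) : (fourMat F u v).1 3 = ![u, v, 1, 0] :=
  rfl

/-- Rescaling X_0, X_1 by 2a + 1, 2b + 1 and shifting X_2 by aX_0 + bX_1 matches the X_0 X_2 and X_1
X_2 terms of the third relation. Its X_0 X_1 term is the condition a + b + 2ab = 0, that is (2a +
1)(2b + 1) = 1, so the inverse arises by exchanging a and b. -/
theorem fourMat_substitution_rel {F : Type*} [Field F] {u v x y : F} (a b : F)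
    (h1 : u * (2 * a + 1) + a = x) (h2 : v * (2 * b + 1) + b = y)
    (h3 : a + b + 2 * a * b = 0) (i : Fin 4) :
    lin (fourMat F x y)
        ((![![2 * a + 1, 0, 0, 0], ![0, 2 * b + 1, 0, 0], ![a, b, 1, 0], ![0, 0, 0, 1]] :
          Fin 4 → Fin 4 → F) i) *
      lin (fourMat F x y)
        ((![![2 * a + 1, 0, 0, 0], ![0, 2 * b + 1, 0, 0], ![a, b, 1, 0], ![0, 0, 0, 1]] :
          Fin 4 → Fin 4 → F) i) =
    (∑ j, (fourMat F u v).1 i j • lin (fourMat F x y)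
        ((![![2 * a + 1, 0, 0, 0], ![0, 2 * b + 1, 0, 0], ![a, b, 1, 0], ![0, 0, 0, 1]] :
          Fin 4 → Fin 4 → F) j)) *
      lin (fourMat F x y)
        ((![![2 * a + 1, 0, 0, 0], ![0, 2 * b + 1, 0, 0], ![a, b, 1, 0], ![0, 0, 0, 1]] :
          Fin 4 → Fin 4 → F) i) := by
  have r0 := gen_mul_self (fourMat F x y) 0
  have r1 := gen_mul_self (fourMat F x y) 1
  have r2 := gen_mul_self (fourMat F x y) 2
  have r3 := gen_mul_self (fourMat F x y) 3
  simp only [fourMat_row_zero, fourMat_row_one, fourMat_row_two, fourMat_row_three, lin_four,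
    zero_smul, one_smul, add_zero, zero_mul, smul_eq_algebraMap_mul] at r0 r1 r2 r3
  have q1 := congrArg (algebraMap F (Alg (fourMat F x y))) h1
  have q2 := congrArg (algebraMap F (Alg (fourMat F x y))) h2
  have q3 := congrArg (algebraMap F (Alg (fourMat F x y))) h3
  simp only [map_add, map_mul, map_one, map_ofNat, map_zero] at q1 q2 q3
  revert i
  refine forall_fin_four ?_ ?_ ?_ ?_ <;>
  simp only [Fin.sum_univ_four, fourMat_row_zero, fourMat_row_one, fourMat_row_two,
    fourMat_row_three, Matrix.cons_val_zero, Matrix.cons_val_one, Matrix.cons_val, lin_four,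
    zero_smul, one_smul, add_zero, zero_add, zero_mul, smul_eq_algebraMap_mul, map_add, map_mul, map_one,
    map_ofNat, map_zero]
  · linear_combination (2 * algebraMap F (Alg (fourMat F x y)) a + 1) ^ 2 * r0
  · linear_combination (2 * algebraMap F (Alg (fourMat F x y)) b + 1) ^ 2 * r1
  · linear_combination r2 - algebraMap F (Alg (fourMat F x y)) a *
      (algebraMap F (Alg (fourMat F x y)) a + 1) * r0 - algebraMap F (Alg (fourMat F x y)) b *
      (algebraMap F (Alg (fourMat F x y)) b + 1) * r1 -
      gen (fourMat F x y) 0 * gen (fourMat F x y) 1 * q3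
  · linear_combination r3 - gen (fourMat F x y) 0 * gen (fourMat F x y) 3 * q1 -
      gen (fourMat F x y) 1 * gen (fourMat F x y) 3 * q2

theorem fourMat_substitution_inv {F : Type*} [Field F] {u v : F} (h : u + v + 2 * u * v = 0)
    (T : SLTM 4 F) (i : Fin 4) :
    ∑ j, (![![2 * u + 1, 0, 0, 0], ![0, 2 * v + 1, 0, 0], ![u, v, 1, 0], ![0, 0, 0, 1]] :
        Fin 4 → Fin 4 → F) i j •
      lin T ((![![2 * v + 1, 0, 0, 0], ![0, 2 * u + 1, 0, 0], ![v, u, 1, 0], ![0, 0, 0, 1]] :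
        Fin 4 → Fin 4 → F) j) = gen T i := by
  have q := congrArg (algebraMap F (Alg T)) h
  simp only [map_add, map_mul, map_ofNat, map_zero] at q
  revert i
  refine forall_fin_four ?_ ?_ ?_ ?_ <;>
  simp only [Fin.sum_univ_four, Matrix.cons_val_zero, Matrix.cons_val_one, Matrix.cons_val,
    lin_four, zero_smul, one_smul, add_zero, zero_add, smul_eq_algebraMap_mul, map_add, map_mul, map_one,
    map_ofNat, map_zero]
  · linear_combination 2 * gen T 0 * q
  · linear_combination 2 * gen T 1 * q
  · linear_combination (gen T 0 + gen T 1) * q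
  · ring

theorem fourMat_sim {F : Type*} [Field F] {u v : F} (h : u + v + 2 * u * v = 0) :
    Sim (fourMat F 0 0) (fourMat F u v) :=
  sim_of_substitution _ _
    (fourMat_substitution_rel u v (by ring) (by ring) h)
    (fourMat_substitution_rel v u (by linear_combination h) (by linear_combination h)
      (by linear_combination h))
    (fourMat_substitution_inv h _)
    (fourMat_substitution_inv (by linear_combination h) _)

theorem fourMat_bounded {F : Type*} [Field F] (u v : F) :
    Bounded (fourMat F u v) ![0, 0, 2, 3] where
  mono := by
    intro i j h
    fin_cases i <;> fin_cases j <;> simp_all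
  le := forall_fin_four (by simp) (by simp) (by simp) (by simp)
  zero := by
    refine forall_fin_four ?_ ?_ ?_ ?_ <;> refine forall_fin_four ?_ ?_ ?_ ?_ <;> simp [fourMat]

theorem fourMat_detects_zero {F : Type*} [Field F] (h2 : (2 : F) ≠ 0) (u v : F) :
    Detects (fourMat F u v) ![0, 0, 2, 3] 0 := by
  refine forall_fin_four (by simp) (by simp) (fun h => ?_) (fun h => ?_)
  · have := co_initial_mul h2 (j := 0) (k := 1) (by decide) (Nat.zero_le _) h
    rw [sgen_mul_self, rowForm, co_lin_mul_lin h2 _ (by decide)] at this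
    simp [fourMat] at this
    exact absurd (by linear_combination this) h2
  · have e1 := co_initial_mul h2 (j := 0) (k := 1) (by decide) (Nat.zero_le _) h
    have e2 := co_initial_mul h2 (j := 0) (k := 2) (by decide) (Nat.zero_le _) h
    have e3 := co_initial_mul h2 (j := 1) (k := 2) (by decide) (Nat.zero_le _) h
    rw [sgen_mul_self, rowForm, co_lin_mul_lin h2 _ (by decide)] at e1 e2 e3
    simp [fourMat] at e1 e2 e3
    refine absurd ?_ (one_ne_zero (α := F))
    -- The three coefficients are 2uv, 2u + 1 and 2v + 1. They cannot vanish together, in any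
    -- characteristic.
    linear_combination e3 - 2 * v * e2 + 2 * e1

/-- In the source, R_3 = X_2 and hence 2Z_3² = 2X_2² = R_2(Z_2 + R_2). Comparing coefficients of the
image of this relation, and of Z_2² = R_2², gives equations in which the scalars of the isomorphism
can be eliminated. -/
theorem quadratic_of_fourMat_sim {F : Type*} [Field F] (h2 : (2 : F) ≠ 0) {S : SLTM 4 F}
    {d : Fin 4 → ℕ} (hS : Bounded S d) (hSd : Detects S d 0) (h : Sim (fourMat F 0 0) S) :
    d 2 ≠ 0 ∧ 2 * S.1 3 0 * S.1 3 1 +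
      S.1 3 2 * (S.1 2 1 * S.1 3 0 + S.1 2 0 * S.1 3 1) = 0 := by
  obtain ⟨e, he⟩ := h
  change IsGr e at he
  have hT := fourMat_bounded (F := F) 0 0
  have hTd := fourMat_detects_zero h2 0 0
  obtain ⟨m, hm, hcm, hdm⟩ := (compat_zero e).next h2 hT hS hTd hSd he
  obtain rfl : m = 2 := by
    have h3 : ((1 : Fin 4) : ℕ) < m := (hcm 1).2 (by simp)
    have h4 : ¬ ((2 : Fin 4) : ℕ) < m := fun h => by simpa using (hcm 2).1 h
    simp at h3 h4
    omega
  have hrow : ∀ i : Fin 4, (i : ℕ) < 2 → S.1 i = 0 := fun i hi =>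
    funext fun j => hS.zero i j (((hdm i).1 hi).trans (Nat.zero_le _))
  refine ⟨fun h0 => by simpa using (hdm 2).2 h0.le, ?_⟩
  obtain ⟨i0, α, -, hα, hi0, hdi0⟩ := exists_sgen_of_le h2 hT hSd he (compat_zero e)
    (Nat.zero_le _) ((hcm 0).1 (by simp))
  obtain ⟨i1, β, -, hβ, hi1, hdi1⟩ := exists_sgen_of_le h2 hT hSd he (compat_zero e)
    (Nat.zero_le _) ((hcm 1).1 (by simp))
  have hi0' := (hdm i0).2 hdi0
  have hi1' := (hdm i1).2 hdi1
  have hne : i0 ≠ i1 := by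
    rintro rfl
    have := eq_of_smul_sgen_eq h2 (fourMat F 0 0) (r := 0) (s := 1) hβ hα (e.injective (by
      rw [map_smul, map_smul, hi0, hi1, smul_comm]))
    simp at this
  obtain ⟨g, hg⟩ := he.exists_lin ((fourMat F 0 0).1 2)
  have hg' : lin S ((2 : F) • g) = α • sgen S i0 + β • sgen S i1 := by
    rw [map_smul, ← hg, ← hi0, ← hi1, ← map_smul, ← map_smul, ← map_add, sgen, sgen, ← map_add]
    congr 2
    ext i
    revert i
    refine forall_fin_four ?_ ?_ ?_ ?_ <;> simp [fourMat]
  have hgi : ∀ i, 2 * g i = α * (Pi.single i0 2 : Fin 4 → F) i + β * (Pi.single i1 2 : Fin 4 → F) i := by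
    intro i
    have := congrArg (coord S i) hg'
    simpa [coord_lin, sgen, hrow i0 hi0', hrow i1 hi1'] using this
  have hg2 : g 2 = 0 := by
    have h := hgi 2
    rw [Pi.single_eq_of_ne (by rintro rfl; simp at hi0'),
      Pi.single_eq_of_ne (by rintro rfl; simp at hi1')] at h
    simpa [h2] using h
  have hg3 : g 3 = 0 := by
    have h := hgi 3
    rw [Pi.single_eq_of_ne (by rintro rfl; simp at hi0'),
      Pi.single_eq_of_ne (by rintro rfl; simp at hi1')] at h
    simpa [h2] using h
  have hg01 : g 0 ≠ 0 ∧ g 1 ≠ 0 := by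
    have a0 := hgi 0
    have a1 := hgi 1
    obtain ⟨rfl, rfl⟩ | ⟨rfl, rfl⟩ : (i0 = 0 ∧ i1 = 1) ∨ (i0 = 1 ∧ i1 = 0) := by
      have : (i0 : ℕ) ≠ i1 := fun h => hne (Fin.ext h)
      simp only [Fin.ext_iff]
      simp
      omega
    all_goals
      simp at a0 a1
      constructor
      · rintro h
        simp [h, h2, hα, hβ] at a0
      · rintro h
        simp [h, h2, hα, hβ] at a1
  have hgen3 : rowForm (fourMat F 0 0) 3 = gen (fourMat F 0 0) 2 := by
    rw [rowForm, fourMat_row_three, lin_four]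
    simp
  obtain ⟨s, γ, hs, hγ, hes, -⟩ := hm.exists_sgen h2 he (r := 2) (by simp)
    (hT.sgen_sq_mem (r := 2) (m := 2) (by simp))
  obtain ⟨a, ha⟩ := he.exists_lin (Pi.single 3 2 - (fourMat F 0 0).1 3)
  change e (sgen (fourMat F 0 0) 3) = lin S a at ha
  have hes' : e (sgen (fourMat F 0 0) 2) = lin S (γ • (Pi.single s 2 - S.1 s)) := by
    rw [hes, sgen, map_smul]
  have hco2 : ∀ j k : Fin 4, j < k → γ * γ * (2 * S.1 s j * S.1 s k + S.1 s k ^ 2 * S.1 k j) =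
      2 * g j * g k + g k ^ 2 * S.1 k j := by
    intro j k hjk
    have h := congrArg e (sgen_mul_self (fourMat F 0 0) 2)
    rw [map_mul, map_mul, hes, rowForm, hg, smul_mul_smul_comm, sgen_mul_self, rowForm] at h
    have h := congrArg (co S j k) h
    rw [map_smul, co_lin_mul_lin h2 S hjk, co_lin_mul_lin h2 S hjk, smul_eq_mul] at h
    linear_combination h
  have hco3 : ∀ j k : Fin 4, j < k → 2 * (2 * a j * a k + a k ^ 2 * S.1 k j) =
      g j * (γ * ((Pi.single s 2 : Fin 4 → F) k - S.1 s k) + g k) +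
      g k * (γ * ((Pi.single s 2 : Fin 4 → F) j - S.1 s j) + g j) +
      g k * (γ * ((Pi.single s 2 : Fin 4 → F) k - S.1 s k) + g k) * S.1 k j := by
    intro j k hjk
    have h1 : 2 * (sgen (fourMat F 0 0) 3 * sgen (fourMat F 0 0) 3) =
        lin (fourMat F 0 0) ((fourMat F 0 0).1 2) *
          (sgen (fourMat F 0 0) 2 + lin (fourMat F 0 0) ((fourMat F 0 0).1 2)) := by
      have h5 := gen_mul_self (fourMat F 0 0) 2
      have h6 : sgen (fourMat F 0 0) 2 = 2 * gen (fourMat F 0 0) 2 -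
          lin (fourMat F 0 0) ((fourMat F 0 0).1 2) := by
        rw [sgen_eq, two_smul, two_mul, rowForm]
      rw [sgen_mul_self, hgen3, h6]
      linear_combination 2 * h5
    have h := congrArg e h1
    rw [map_mul, map_mul, map_mul, map_add, map_ofNat, ha, hes', hg, ← map_add, two_mul] at h
    have h := congrArg (co S j k) h
    rw [map_add, co_lin_mul_lin h2 S hjk, co_lin_mul_lin h2 S hjk] at h
    simp only [Pi.add_apply, Pi.smul_apply, Pi.sub_apply, smul_eq_mul] at h
    linear_combination h
  -- Modulo the first two generators the images of Z_2 and Z_3 stay independent: otherwise a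
  -- combination with nonzero coordinate at index 3 would lie in the initial span of length 2.
  have hbad : ∀ x : F, a 2 - x * ((Pi.single s 2 : Fin 4 → F) 2 - S.1 s 2) = 0 →
      a 3 - x * ((Pi.single s 2 : Fin 4 → F) 3 - S.1 s 3) = 0 → False := by
    intro x hx2 hx3
    have hmem : lin S (a - x • (Pi.single s 2 - S.1 s)) ∈ initial S 2 := by
      rw [lin_mem_initial]
      refine forall_fin_four (by simp) (by simp) (fun _ => hx2) (fun _ => hx3)
    have h := hm.2 _ hmem
    have h' : lin S (a - x • (Pi.single s 2 - S.1 s)) =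
        e (sgen (fourMat F 0 0) 3 - (x * γ⁻¹) • sgen (fourMat F 0 0) 2) := by
      rw [map_sub e, map_smul e, ha, hes, smul_smul, mul_assoc, inv_mul_cancel₀ hγ, mul_one, sgen,
        ← map_smul, ← map_sub]
    rw [h', e.symm_apply_apply] at h
    have h := coord_initial h (i := 3) (by simp)
    rw [map_sub, map_smul, coord_sgen_self, coord_sgen_of_lt _ (by decide)] at h
    simp [h2] at h
  have hs' : s = 2 ∨ s = 3 := by
    revert hs
    clear hes hes' hco2 hco3 hbad
    revert s
    exact forall_fin_four (by simp) (by simp) (by simp) (by simp)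
  have h32 := hco3 2 3 (by decide)
  rw [hg2, hg3] at h32
  have h32' : a 3 * (2 * a 2 + a 3 * S.1 3 2) = 0 :=
    mul_left_cancel₀ h2 (by linear_combination h32)
  have h30 := hco3 0 3 (by decide)
  have h31 := hco3 1 3 (by decide)
  rw [hg3] at h30 h31
  have hS33 := S.2 3 3 le_rfl
  have hS22 := S.2 2 2 le_rfl
  have hS23 := S.2 2 3 (by decide)
  rcases hs' with rfl | rfl
  · have ha3 : a 3 ≠ 0 := by
      intro ha3
      refine hbad (a 2 / 2) ?_ ?_
      · rw [hS22, Pi.single_eq_same]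
        field_simp
        ring
      · rw [hS23, ha3, Pi.single_eq_of_ne (by decide)]
        ring
    have e2 := (mul_eq_zero.1 h32').resolve_left ha3
    rw [hS23, Pi.single_eq_of_ne (by decide)] at h30 h31
    have e0 : 2 * a 0 + a 3 * S.1 3 0 = 0 := by
      refine (mul_eq_zero.1 (?_ : a 3 * (2 * a 0 + a 3 * S.1 3 0) = 0)).resolve_left ha3
      exact mul_left_cancel₀ h2 (by linear_combination h30)
    have e1 : 2 * a 1 + a 3 * S.1 3 1 = 0 := by
      refine (mul_eq_zero.1 (?_ : a 3 * (2 * a 1 + a 3 * S.1 3 1) = 0)).resolve_left ha3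
      exact mul_left_cancel₀ h2 (by linear_combination h31)
    have c01 := hco2 0 1 (by decide)
    have d01 := hco3 0 1 (by decide)
    have d02 := hco3 0 2 (by decide)
    have d12 := hco3 1 2 (by decide)
    have hS10 : S.1 1 0 = 0 := congrFun (hrow 1 (by simp)) 0
    rw [hS10] at c01 d01
    rw [hg2, hS22, Pi.single_eq_same] at d02 d12
    rw [Pi.single_eq_of_ne (by decide), Pi.single_eq_of_ne (by decide)] at d01
    generalize S.1 2 0 = p at *
    generalize S.1 2 1 = q at *
    generalize S.1 3 0 = u at *
    generalize S.1 3 1 = v at *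
    generalize S.1 3 2 = w at *
    -- The equations `e0`, `e1`, `e2` say that Z_3 maps to κ times the completed generator of row 3
    -- of S.
    obtain ⟨κ, hκ⟩ : ∃ κ, a 3 = 2 * κ := ⟨a 3 / 2, by field_simp⟩
    have hκ0 : κ ≠ 0 := by
      rintro rfl
      exact ha3 (by rw [hκ, mul_zero])
    have b0 : a 0 = - (κ * u) := mul_left_cancel₀ h2 (by rw [hκ] at e0; linear_combination e0)
    have b1 : a 1 = - (κ * v) := mul_left_cancel₀ h2 (by rw [hκ] at e1; linear_combination e1)
    have b2 : a 2 = - (κ * w) := mul_left_cancel₀ h2 (by rw [hκ] at e2; linear_combination e2)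
    rw [b0, b1] at d01
    rw [b0, b2] at d02
    rw [b1, b2] at d12
    have E1 : γ ^ 2 * (p * q) = g 0 * g 1 := mul_left_cancel₀ h2 (by linear_combination c01)
    have E3 : κ ^ 2 * w * (w * p + 2 * u) = γ * g 0 :=
      mul_left_cancel₀ h2 (by linear_combination d02)
    have E4 : κ ^ 2 * w * (w * q + 2 * v) = γ * g 1 :=
      mul_left_cancel₀ h2 (by linear_combination d12)
    have E5 : κ ^ 2 * (2 * u * v + w * (q * u + p * v) + w ^ 2 * p * q) = g 0 * g 1 :=
      mul_left_cancel₀ h2 (by linear_combination d01 + q * E3 + p * E4)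
    -- With D = 2uv + w(qu + pv), the equations E1, E3 and E4 give pq κ⁴w²(wp + 2u)(wq + 2v) = (g 0
    -- g 1)², and E5 squared gives κ⁴(D + w²pq)² = (g 0 g 1)². The difference of the left-hand sides
    -- is (κ²D)².
    have E6 : (κ ^ 2 * (2 * u * v + w * (q * u + p * v))) ^ 2 = 0 := by
      linear_combination (κ ^ 2 * (2 * u * v + w * (q * u + p * v) + w ^ 2 * p * q) + g 0 * g 1) *
        E5 - p * q * κ ^ 2 * w * (w * q + 2 * v) * E3 - p * q * γ * g 0 * E4 - g 0 * g 1 * E1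
    exact (mul_eq_zero.1 ((pow_eq_zero_iff two_ne_zero).1 E6)).resolve_left (pow_ne_zero 2 hκ0)
  -- If Z_2 went to row 3, the coefficients at X_0 X_3 and X_2 X_3 would make the image of Z_3
  -- proportional to that of Z_2 modulo the first two generators.
  · exfalso
    rw [hS33, Pi.single_eq_same] at h30
    have ha3 : a 3 ≠ 0 := by
      intro ha3
      rw [ha3] at h30
      exact mul_ne_zero h2 (mul_ne_zero hγ hg01.1) (by linear_combination -h30)
    have e2 := (mul_eq_zero.1 h32').resolve_left ha3
    refine hbad (a 3 / 2) ?_ ?_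
    · rw [Pi.single_eq_of_ne (by decide)]
      field_simp
      linear_combination e2
    · rw [hS33, Pi.single_eq_same]
      field_simp
      ring

/-! ### Lattice paths -/

/-- The number of steps `D` before the `k`-th step `U` (counted from `0`). -/
def downsBefore : List DyckStep → ℕ → ℕ
  | [], _ => 0
  | DyckStep.D :: l, k => downsBefore l k + 1
  | DyckStep.U :: _, 0 => 0
  | DyckStep.U :: l, k + 1 => downsBefore l k

theorem downsBefore_le_succ (l : List DyckStep) (k : ℕ) :
    downsBefore l k ≤ downsBefore l (k + 1) := by
  induction l generalizing k with
  | nil => exact le_rfl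
  | cons s l ih =>
    cases s with
    | U => cases k with
      | zero => exact Nat.zero_le _
      | succ k => exact ih k
    | D => exact Nat.succ_le_succ (ih k)

theorem exists_take_count (l : List DyckStep) (k : ℕ) :
    ∃ i, (l.take i).count DyckStep.D = downsBefore l k ∧ (l.take i).count DyckStep.U ≤ k := by
  induction l generalizing k with
  | nil => exact ⟨0, by simp [downsBefore]⟩
  | cons s l ih =>
    cases s with
    | U => cases k with
      | zero => exact ⟨0, by simp [downsBefore]⟩
      | succ k =>
        obtain ⟨i, h1, h2⟩ := ih k
        exact ⟨i + 1, by simp [downsBefore, h1], by simpa using h2⟩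
    | D =>
      obtain ⟨i, h1, h2⟩ := ih k
      exact ⟨i + 1, by simp [downsBefore, h1], by simpa using h2⟩

/-- The ballot condition of the Dyck word, applied to the prefix preceding the k-th step `U`. -/
theorem downsBefore_le (P : DyckWord) (k : ℕ) : downsBefore P.toList k ≤ k := by
  obtain ⟨i, h1, h2⟩ := exists_take_count P.toList k
  rw [← h1]
  exact (P.count_D_le_count_U i).trans h2

theorem eq_of_downsBefore_eq {l l' : List DyckStep}
    (hU : l.count DyckStep.U = l'.count DyckStep.U) (hD : l.count DyckStep.D = l'.count DyckStep.D)
    (h : ∀ k < l.count DyckStep.U, downsBefore l k = downsBefore l' k) : l = l' := by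
  induction l generalizing l' with
  | nil => cases l' with
    | nil => rfl
    | cons s l' => cases s <;> simp at hU hD
  | cons s l ih => cases l' with
    | nil => cases s <;> simp at hU hD
    | cons s' l' =>
      cases s <;> cases s'
      · simp at hU hD
        rw [ih hU hD fun k hk => h (k + 1) (by simpa using hk)]
      · have := h 0 (by simp)
        simp [downsBefore] at this
      · have := h 0 (by rw [hU]; simp)
        simp [downsBefore] at this
      · simp at hU hD
        rw [ih hU hD fun k hk => by simpa [downsBefore] using h k (by simpa using hk)]

/-- The row lengths of the staircase matrix of a path, read off its vertical steps. -/
def dyckLength (n : ℕ) (P : DyckWord) (i : Fin n) : ℕ :=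
  if downsBefore P.toList (i - 1) = 0 then 0 else downsBefore P.toList (i - 1) + 1

theorem dyckLength_le (n : ℕ) (P : DyckWord) (i : Fin n) : dyckLength n P i ≤ i := by
  have := downsBefore_le P (i - 1)
  unfold dyckLength
  split_ifs <;> omega

theorem dyckLength_ne_one (n : ℕ) (P : DyckWord) (i : Fin n) : dyckLength n P i ≠ 1 := by
  unfold dyckLength
  split_ifs <;> omega

theorem dyckLength_mono (n : ℕ) (P : DyckWord) : Monotone (dyckLength n P) := by
  intro i j hij
  have : (i : ℕ) ≤ j := hij
  have := monotone_nat_of_le_succ (downsBefore_le_succ P.toList) (Nat.sub_le_sub_right this 1)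
  unfold dyckLength
  split_ifs <;> omega

/-- Row k + 1 records the steps before the k-th `U`. Raising the positive counts by one only skips
the forbidden length 1 and loses no information. -/
theorem dyckLength_injective {n : ℕ} {P Q : DyckWord} (hP : P.semilength = n - 1)
    (hQ : Q.semilength = n - 1) (h : dyckLength n P = dyckLength n Q) : P = Q := by
  refine DyckWord.ext (eq_of_downsBefore_eq (hP.trans hQ.symm) ?_ fun k hk => ?_)
  · rw [← P.count_U_eq_count_D, ← Q.count_U_eq_count_D]
    exact hP.trans hQ.symm
  · have hk' : k < n - 1 := hP ▸ hk
    have := congrFun h ⟨k + 1, by omega⟩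
    simp only [dyckLength, Nat.add_sub_cancel] at this
    split_ifs at this <;> omega

/-- The row lengths of `Psi n F P`. -/
noncomputable def psiLength (n : ℕ) (P : DyckWord) (i : Fin n) : ℕ :=
  letI := Classical.decPred fun k => ∃ r, IsTurn P r k ∧ r ≤ (i : ℕ) + 1
  ((Finset.range n).filter fun k => ∃ r, IsTurn P r k ∧ r ≤ (i : ℕ) + 1).sup id

theorem lt_psiLength_iff {n : ℕ} {P : DyckWord} {i : Fin n} {j : ℕ} :
    j < psiLength n P i ↔ ∃ r c, IsTurn P r c ∧ r ≤ (i : ℕ) + 1 ∧ j + 1 ≤ c := by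
  classical
  rw [psiLength, Finset.lt_sup_iff]
  constructor
  · rintro ⟨c, hc, hj⟩
    obtain ⟨r, hr, hri⟩ := (Finset.mem_filter.1 hc).2
    exact ⟨r, c, hr, hri, hj⟩
  · rintro ⟨r, c, hr, hri, hj⟩
    -- Turning columns lie left of the diagonal, so c < r ≤ i + 1 ≤ n and the range in `psiLength`
    -- misses none.
    refine ⟨c, Finset.mem_filter.2 ⟨Finset.mem_range.2 ?_, r, hr, hri⟩, hj⟩
    have := hr.lt
    have := i.2
    omega

theorem psiLength_le (n : ℕ) (P : DyckWord) (i : Fin n) : psiLength n P i ≤ i := by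
  by_contra h
  obtain ⟨r, c, hr, hri, hc⟩ := lt_psiLength_iff.1 (not_le.1 h)
  have := hr.lt
  omega

theorem psiLength_mono (n : ℕ) (P : DyckWord) : Monotone (psiLength n P) := by
  intro i j hij
  have hij' : (i : ℕ) ≤ j := hij
  by_contra h
  obtain ⟨r, c, hr, hri, hc⟩ := lt_psiLength_iff.1 (not_le.1 h)
  exact lt_irrefl _ (lt_psiLength_iff.2 ⟨r, c, hr, by omega, hc⟩)

theorem psiLength_ne_one (n : ℕ) (P : DyckWord) (i : Fin n) : psiLength n P i ≠ 1 := by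
  intro h
  obtain ⟨r, c, hr, hri, hc⟩ := lt_psiLength_iff.1 (h ▸ zero_lt_one : 0 < psiLength n P i)
  have : 1 < psiLength n P i := lt_psiLength_iff.2 ⟨r, c, hr, hri, by
    obtain ⟨a, b, -, -, rfl⟩ := hr
    omega⟩
  omega

theorem Psi_eq_stair (n : ℕ) (F : Type*) [Field F] (P : DyckWord) :
    Psi n F P = stair n 1 (psiLength n P) (psiLength_le n P) := by
  classical
  refine Subtype.ext (Matrix.ext fun i j => ?_)
  have h := lt_psiLength_iff (P := P) (i := i) (j := j)
  have hle := psiLength_le n P i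
  rw [stair_apply]
  change (if j < i then if ∃ r c, IsTurn P r c ∧ r ≤ (i : ℕ) + 1 ∧ (j : ℕ) + 1 ≤ c
    then (1 : F) else 0 else 0) = _
  rw [← h]
  by_cases hj : (j : ℕ) < psiLength n P i
  · rw [if_pos (show j < i from Fin.lt_def.2 (by omega)), if_pos hj]
    split_ifs
    · rfl
    · rfl
    · omega
  · rw [if_neg hj, ite_self, if_neg (by omega), if_neg (by omega)]

theorem Psi_full (n : ℕ) (F : Type*) [Field F] (P : DyckWord) :
    Full (Psi n F P) (psiLength n P) := by
  rw [Psi_eq_stair]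
  exact stair_full one_ne_zero _ (psiLength_mono n P)

/-- The quadratic equation forces c 2 = 2, leaving two shapes: it reads 2μ = 0 if c 3 = 2, and μ² +
μ + 2 = 0 if c 3 = 3. -/
theorem not_sim_fourMat_stair {F : Type*} [Field F] (h2 : (2 : F) ≠ 0) {μ : F} (hμ : μ ≠ 0)
    (hμ' : μ ^ 2 + μ + 2 ≠ 0) {c : Fin 4 → ℕ} (hc : ∀ i, c i ≤ i) (hmono : Monotone c)
    (h1 : ∀ i, c i ≠ 1) : ¬ Sim (fourMat F 0 0) (stair 4 μ c hc) := by
  intro h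
  have hS := stair_full hμ hc hmono
  obtain ⟨hc0, hq⟩ := quadratic_of_fourMat_sim h2 hS.toBounded (hS.detects_zero h2 h1) h
  have a2 := h1 2
  have a3 : c 2 ≤ 2 := hc 2
  have a4 : c 3 ≤ 3 := hc 3
  have a5 : c 2 ≤ c 3 := hmono (by decide)
  have b2 : c 2 = 2 := by omega
  obtain b3 | b3 : c 3 = 2 ∨ c 3 = 3 := by omega
  · simp [stair_apply, b2, b3] at hq
    exact hq.elim h2 hμ
  · simp [stair_apply, b2, b3] at hq
    exact hμ' (by linear_combination hq)

/-! ### Counting classes -/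

/-- The -1 staircases of Dyck words are pairwise inequivalent, and X adds one more class; adjoining
a point to the set of Dyck words records both facts in one injection. -/
theorem catalan_lt_of_not_sim {n : ℕ} {F : Type*} [Field F] (h2 : (2 : F) ≠ 0) (X : SLTM n F)
    (hX : ∀ (c : Fin n → ℕ) (hc : ∀ i, c i ≤ i), Monotone c → (∀ i, c i ≠ 1) →
      ¬ Sim X (stair n (-1) c hc)) :
    (catalan (n - 1) : Cardinal) < numClasses n F := by
  let f : Option {P : DyckWord // P.semilength = n - 1} → Quotient (simSetoid n F) := fun o =>
    o.elim (Quotient.mk (simSetoid n F) X) fun P =>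
      Quotient.mk (simSetoid n F) (stair n (-1) (dyckLength n P.1) (dyckLength_le n P.1))
  have hnot : ∀ P : {P : DyckWord // P.semilength = n - 1}, f none ≠ f (some P) := fun P h =>
    hX _ (dyckLength_le n P.1) (dyckLength_mono n P.1) (dyckLength_ne_one n P.1)
      (Quotient.exact h)
  have hf : Function.Injective f := by
    rintro (_ | P) (_ | Q) h
    · rfl
    · exact absurd h (hnot Q)
    · exact absurd h.symm (hnot P)
    · have hs : Sim _ _ := Quotient.exact h
      have := stair_neg_one_injective h2 _ _ (dyckLength_mono n P.1) (dyckLength_mono n Q.1)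
        (dyckLength_ne_one n P.1) (dyckLength_ne_one n Q.1) hs
      rw [Subtype.ext (dyckLength_injective P.2 Q.2 this)]
  have hle := Cardinal.mk_le_of_injective (hf.comp ULift.down_injective)
  rw [Cardinal.mk_uLift, Cardinal.mk_fintype, Fintype.card_option,
    DyckWord.card_dyckWord_semilength_eq_catalan, Cardinal.lift_natCast] at hle
  refine lt_of_lt_of_le ?_ hle
  exact_mod_cast Nat.lt_succ_self _

theorem catalan_lt_numClasses {n : ℕ} (F : Type*) [Field F] (h2 : (2 : F) ≠ 0) (hn : 4 ≤ n) :
    (catalan (n - 1) : Cardinal) < numClasses n F := by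
  obtain rfl | hn := hn.eq_or_lt
  · refine catalan_lt_of_not_sim h2 (fourMat F 0 0) fun c hc hm h1 =>
      not_sim_fourMat_stair h2 (neg_ne_zero.2 one_ne_zero) ?_ hc hm h1
    -- At μ = -1 the polynomial μ² + μ + 2 takes the value 2.
    intro h
    exact h2 (by linear_combination h)
  · exact catalan_lt_of_not_sim h2 (extra n F) fun c hc hm h1 =>
      not_sim_extra_full h2 hn (stair_full (neg_ne_zero.2 one_ne_zero) hc hm) h1

/-! ### Matrices with a single brick starting at row `4` -/

theorem ent_ofEntries {n : ℕ} {F : Type*} [Field F] (f : ℕ → ℕ → F) (r c : ℕ) :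
    (ofEntries n F f).ent r c = if 1 ≤ c ∧ c < r ∧ r ≤ n then f r c else 0 := by
  unfold ent
  by_cases h : (1 ≤ r ∧ r ≤ n) ∧ (1 ≤ c ∧ c ≤ n)
  · rw [dif_pos h]
    change (if (⟨c - 1, _⟩ : Fin n) < ⟨r - 1, _⟩ then f (r - 1 + 1) (c - 1 + 1) else 0) = _
    rw [Nat.sub_add_cancel h.1.1, Nat.sub_add_cancel h.2.1]
    refine if_congr ?_ rfl rfl
    rw [Fin.lt_def]
    simp only
    omega
  · rw [dif_neg h, if_neg (by omega)]

theorem leaderCol_eq {n : ℕ} {F : Type*} [Field F] {T : SLTM n F} {r c : ℕ} (h1 : 1 ≤ c)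
    (hn : c ≤ n) (hc : T.ent r c ≠ 0) (h : ∀ k, c < k → T.ent r k = 0) : T.leaderCol r = c := by
  classical
  refine le_antisymm (Finset.sup_le fun k hk => ?_)
    (Finset.le_sup (f := id) (Finset.mem_filter.2 ⟨Finset.mem_Icc.2 ⟨h1, hn⟩, hc⟩))
  by_contra hlt
  exact (Finset.mem_filter.1 hk).2 (h k (not_le.1 hlt))

theorem leaderCol_eq_zero {n : ℕ} {F : Type*} [Field F] {T : SLTM n F} {r : ℕ}
    (h : ∀ k, T.ent r k = 0) : T.leaderCol r = 0 := by
  classical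
  refine Nat.eq_zero_of_le_zero (Finset.sup_le fun k hk => ?_)
  exact absurd (h k) (Finset.mem_filter.1 hk).2

/-- The first three rows vanish; the other rows have leader columns `L r ∈ {2, 3}`, weakly
increasing in `r`, and exactly two nonzero entries, one of them in the first column. -/
structure OneBrick {n : ℕ} {F : Type*} [Field F] (T : SLTM n F) (L : ℕ → ℕ) : Prop where
  zero : ∀ r c, r < 4 → T.ent r c = 0
  lead : ∀ r ∈ Set.Icc 4 n, T.leaderCol r = L r
  bound : ∀ r, 2 ≤ L r ∧ L r ≤ 3
  mono : ∀ r ∈ Set.Ico 4 n, L r ≤ L (r + 1)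
  first : ∀ r ∈ Set.Icc 4 n, T.ent r 1 ≠ 0
  measure : ∀ r ∈ Set.Icc 4 n, T.brickMeasure [4] 1 r = 2

theorem OneBrick.leaderCol_zero {n : ℕ} {F : Type*} [Field F] {T : SLTM n F} {L : ℕ → ℕ}
    (h : OneBrick T L) {r : ℕ} (hr : r ≤ n) : T.leaderCol r = 0 ↔ r < 4 := by
  constructor
  · intro h0
    by_contra h4
    rw [h.lead r ⟨not_lt.1 h4, hr⟩] at h0
    have := (h.bound r).1
    omega
  · exact fun h4 => leaderCol_eq_zero fun k => h.zero r k h4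

/-- The leader's column is 2 or 3 and the row of that index is zero, so the test at column 1 reduces
to 2 t_{r1}. -/
theorem OneBrick.leadersIrreducible {n : ℕ} {F : Type*} [Field F] (h2 : (2 : F) ≠ 0)
    {T : SLTM n F} {L : ℕ → ℕ} (h : OneBrick T L) : T.LeadersIrreducible := by
  intro r hr h0
  have h4 : 4 ≤ r := not_lt.1 fun h4 => h0 ((h.leaderCol_zero hr.2).2 h4)
  have hb := h.bound r
  rw [h.lead r ⟨h4, hr.2⟩]
  refine ⟨hb.1, 1, ⟨le_rfl, hb.1⟩, ?_⟩
  rw [delta, h.zero (L r) 1 (by omega), mul_zero, add_zero]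
  exact mul_ne_zero h2 (h.first r ⟨h4, hr.2⟩)

theorem OneBrick.isWallREF1 {n : ℕ} {F : Type*} [Field F] (h2 : (2 : F) ≠ 0) (hn : 5 ≤ n)
    {T : SLTM n F} {L : ℕ → ℕ} (h : OneBrick T L) : T.IsWallREF1 [4] := by
  refine ⟨Or.inr ⟨?_, h.leadersIrreducible h2, ?_⟩, Or.inr ⟨4, ⟨⟨⟨by omega, by omega⟩, ?_⟩, ?_⟩,
    WallFrom.last 4 ?_⟩⟩
  · intro r hr s hs hr0 hs0
    have h1 := (h.leaderCol_zero hr.2).1 hr0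
    have h3 := mt (h.leaderCol_zero hs.2).2 hs0
    omega
  · intro r hr hr0 _
    have h1 := mt (h.leaderCol_zero hr.2.le).2 hr0
    rw [h.lead r ⟨by omega, hr.2.le⟩, h.lead (r + 1) ⟨by omega, hr.2⟩]
    exact h.mono r ⟨by omega, hr.2⟩
  · rw [Ne, h.leaderCol_zero (by omega)]
    omega
  · rintro r ⟨hr, hr0⟩
    exact not_lt.1 (mt (h.leaderCol_zero hr.2).2 hr0)
  · intro s hs
    rw [h.lead s ⟨hs.1.le, hs.2⟩]
    have := h.bound s
    omega

theorem OneBrick.isREF2With {n : ℕ} {F : Type*} [Field F] (h2 : (2 : F) ≠ 0) (hn : 5 ≤ n)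
    {T : SLTM n F} {L : ℕ → ℕ} (h : OneBrick T L) (h0 : ¬ Sim T ⟨0, fun _ _ _ => rfl⟩) :
    T.IsREF2With [4] := by
  refine ⟨h0, ⟨T, (sim_equivalence n F).refl T, h.isWallREF1 h2 hn⟩,
    fun r hr => h.leaderCol_zero hr.2, h.leadersIrreducible h2, ?_, ?_⟩
  · rintro j ⟨hj1, hj2⟩ r hr
    obtain rfl : j = 1 := le_antisymm hj2 hj1
    have hr' : 4 ≤ r ∧ r < n + 1 := hr
    rw [h.lead r ⟨hr'.1, by omega⟩]
    have := h.bound r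
    change 1 ≤ L r ∧ L r < 4
    omega
  · rintro j ⟨hj1, hj2⟩ r hr1 hr2
    obtain rfl : j = 1 := le_antisymm hj2 hj1
    change 4 ≤ r at hr1
    change r + 1 < n + 1 at hr2
    rw [h.measure r ⟨hr1, by omega⟩, h.measure (r + 1) ⟨by omega, by omega⟩]

theorem OneBrick.isMeasureSeq {n : ℕ} {F : Type*} [Field F] (hn : 5 ≤ n)
    {T : SLTM n F} {L : ℕ → ℕ} (h : OneBrick T L) : T.IsMeasureSeq [4] [[(4, 2)]] := by
  refine ⟨rfl, ?_⟩
  rintro j ⟨hj1, hj2⟩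
  obtain rfl : j = 1 := le_antisymm hj2 hj1
  have h4 := h.measure 4 ⟨le_rfl, by omega⟩
  have := MeasureFrom.last (T := T) (w := [4]) (j := 1) 4 (by
    intro s hs
    have hs' : 4 < s ∧ s < n + 1 := hs
    rw [h4, h.measure s ⟨by omega, by omega⟩])
  rw [h4] at this
  exact this

/-! ### The two matrices separated by the `(I, J)`-test -/

theorem extra_ent (n : ℕ) (F : Type*) [Field F] (hn : 5 ≤ n) (r c : ℕ) :
    (extra n F).ent r c = if (4 ≤ r ∧ r < n ∧ (c = 1 ∨ c = 2)) ∨ (r = n ∧ (c = 1 ∨ c = 3))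
      then 1 else 0 := by
  rw [extra, ent_ofEntries]
  split_ifs
  · rfl
  · rfl
  · omega
  · rfl

theorem brickSupp_four {n : ℕ} {F : Type*} [Field F] (T : SLTM n F) (r : ℕ) :
    T.brickSupp [4] 1 r = {c | 1 ≤ c ∧ c < 4 ∧ T.ent r c ≠ 0} :=
  Set.ext fun _ => and_assoc

theorem extra_oneBrick {n : ℕ} (F : Type*) [Field F] (hn : 5 ≤ n) :
    OneBrick (extra n F) fun r => if r < n then 2 else 3 where
  zero r c hr := by
    rw [extra_ent n F hn, if_neg (by omega)]
  lead r hr := by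
    have := hr.1
    have := hr.2
    split_ifs with h
    · refine leaderCol_eq (by omega) (by omega) ?_ fun k hk => ?_
      · rw [extra_ent n F hn, if_pos (by omega)]
        exact one_ne_zero
      · rw [extra_ent n F hn, if_neg (by omega)]
    · refine leaderCol_eq (by omega) (by omega) ?_ fun k hk => ?_
      · rw [extra_ent n F hn, if_pos (by omega)]
        exact one_ne_zero
      · rw [extra_ent n F hn, if_neg (by omega)]
  bound r := by split_ifs <;> omega
  mono r hr := by split_ifs <;> omega
  first r hr := by
    have := hr.1
    have := hr.2
    rw [extra_ent n F hn, if_pos (by omega)]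
    exact one_ne_zero
  measure r hr := by
    have := hr.1
    have := hr.2
    rw [brickMeasure, brickSupp_four]
    by_cases h : r < n
    · rw [← Set.ncard_pair (show (1 : ℕ) ≠ 2 by decide)]
      congr 1
      ext c
      simp only [extra_ent n F hn, Set.mem_ofPred_eq, Set.mem_insert_iff, Set.mem_singleton_iff,
        ne_eq, ite_eq_right_iff, one_ne_zero, imp_false, not_not]
      omega
    · rw [← Set.ncard_pair (show (1 : ℕ) ≠ 3 by decide)]
      congr 1
      ext c
      simp only [extra_ent n F hn, Set.mem_ofPred_eq, Set.mem_insert_iff, Set.mem_singleton_iff,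
        ne_eq, ite_eq_right_iff, one_ne_zero, imp_false, not_not]
      omega

theorem Psi_ent_of_turn {n : ℕ} (F : Type*) [Field F] {P : DyckWord}
    (hP : ∀ r c : ℕ, IsTurn P r c ↔ r = 4 ∧ c = 2) (r c : ℕ) :
    (Psi n F P).ent r c = if 4 ≤ r ∧ r ≤ n ∧ (c = 1 ∨ c = 2) then 1 else 0 := by
  classical
  rw [Psi, ent_ofEntries]
  have : (∃ r' c', IsTurn P r' c' ∧ r' ≤ r ∧ c ≤ c') ↔ 4 ≤ r ∧ c ≤ 2 := by
    constructor
    · rintro ⟨r', c', h, h'⟩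
      obtain ⟨rfl, rfl⟩ := (hP r' c').1 h
      exact h'
    · exact fun h => ⟨4, 2, (hP 4 2).2 ⟨rfl, rfl⟩, h⟩
  simp only [this]
  split_ifs
  · rfl
  · omega
  · omega
  · rfl
  · omega
  · rfl

theorem Psi_oneBrick {n : ℕ} (F : Type*) [Field F] (hn : 5 ≤ n) {P : DyckWord}
    (hP : ∀ r c : ℕ, IsTurn P r c ↔ r = 4 ∧ c = 2) : OneBrick (Psi n F P) fun _ => 2 where
  zero r c hr := by
    rw [Psi_ent_of_turn F hP, if_neg (by omega)]
  lead r hr := by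
    have := hr.1
    have := hr.2
    refine leaderCol_eq (by omega) (by omega) ?_ fun k hk => ?_
    · rw [Psi_ent_of_turn F hP, if_pos (by omega)]
      exact one_ne_zero
    · rw [Psi_ent_of_turn F hP, if_neg (by omega)]
  bound r := by omega
  mono r hr := le_rfl
  first r hr := by
    have := hr.1
    have := hr.2
    rw [Psi_ent_of_turn F hP, if_pos (by omega)]
    exact one_ne_zero
  measure r hr := by
    have := hr.1
    have := hr.2
    rw [brickMeasure, brickSupp_four, ← Set.ncard_pair (show (1 : ℕ) ≠ 2 by decide)]
    congr 1
    ext c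
    simp only [Psi_ent_of_turn F hP, Set.mem_ofPred_eq, Set.mem_insert_iff,
      Set.mem_singleton_iff, ne_eq, ite_eq_right_iff, one_ne_zero, imp_false, not_not]
    omega

/-- Rows 4, …, n of `Psi` share one support, so its ρ-image would be the support of every row of
`extra` from 4 to n. Rows 4 and n have the different supports {1,2} and {1,3}. -/
theorem not_ijCompatible_extra_Psi {n : ℕ} (F : Type*) [Field F] (hn : 5 ≤ n) {P : DyckWord}
    (hP : ∀ r c : ℕ, IsTurn P r c ↔ r = 4 ∧ c = 2) (M : List (List (ℕ × ℕ))) :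
    ¬ IJCompatible (extra n F) (Psi n F P) [4] M := by
  rintro ⟨ρ, -, h1, -, h3⟩
  have h1' : ρ '' Set.Ico 4 (n + 1) = Set.Ico 4 (n + 1) := h1 1 ⟨le_rfl, le_rfl⟩
  have h3' : ∀ k ∈ Set.Ico 4 (n + 1),
      ρ '' (Psi n F P).brickSupp [4] 1 k = (extra n F).brickSupp [4] 1 (ρ k) :=
    h3 1 ⟨le_rfl, le_rfl⟩
  have hconst : ∀ k ∈ Set.Ico 4 (n + 1), (Psi n F P).brickSupp [4] 1 k =
      (Psi n F P).brickSupp [4] 1 4 := by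
    rintro k ⟨hk1, hk2⟩
    rw [brickSupp_four, brickSupp_four]
    ext c
    simp only [Psi_ent_of_turn F hP, Set.mem_ofPred_eq, ne_eq, ite_eq_right_iff, one_ne_zero,
      imp_false, not_not]
    omega
  obtain ⟨k, hk, hk4⟩ : (4 : ℕ) ∈ ρ '' Set.Ico 4 (n + 1) := by
    rw [h1']
    exact ⟨le_rfl, by omega⟩
  obtain ⟨l, hl, hln⟩ : n ∈ ρ '' Set.Ico 4 (n + 1) := by
    rw [h1']
    exact ⟨by omega, by omega⟩
  have heq := (h3' k hk).symm.trans ((by rw [hconst k hk, hconst l hl] :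
    ρ '' (Psi n F P).brickSupp [4] 1 k = ρ '' (Psi n F P).brickSupp [4] 1 l).trans (h3' l hl))
  rw [hk4, hln, brickSupp_four, brickSupp_four] at heq
  have h2 : (2 : ℕ) ∈ {c | 1 ≤ c ∧ c < 4 ∧ (extra n F).ent 4 c ≠ 0} := by
    refine ⟨by decide, by decide, ?_⟩
    rw [extra_ent n F hn, if_pos (by omega)]
    exact one_ne_zero
  rw [heq] at h2
  refine h2.2.2 ?_
  rw [extra_ent n F hn, if_neg (by omega)]

/-- The path whose only turn from rightwards to downwards is at `(4, 2)`. -/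
def singleTurnPath (m : ℕ) : DyckWord where
  toList := DyckStep.U :: DyckStep.U :: DyckStep.D ::
    (List.replicate (m + 1) DyckStep.U ++ List.replicate (m + 2) DyckStep.D)
  count_U_eq_count_D := by simp [List.count_replicate]
  count_D_le_count_U := by
    rintro (_ | _ | _ | i)
    · simp
    · simp
    · simp
    · simp [List.take_append, List.count_replicate]
      omega

theorem singleTurnPath_semilength (m : ℕ) : (singleTurnPath m).semilength = m + 3 := by
  simp [DyckWord.semilength, singleTurnPath, List.count_replicate]

theorem replicate_append_replicate_ne (m k : ℕ) (a b : List DyckStep) :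
    List.replicate m DyckStep.U ++ List.replicate k DyckStep.D ≠
      a ++ DyckStep.D :: DyckStep.U :: b := by
  induction m generalizing a with
  | zero =>
    intro h
    have : DyckStep.U ∈ List.replicate k DyckStep.D := by
      have h' : List.replicate k DyckStep.D = a ++ DyckStep.D :: DyckStep.U :: b := by simpa using h
      rw [h']
      simp
    simpa using List.eq_of_mem_replicate this
  | succ m ih =>
    intro h
    cases a with
    | nil => simp [List.replicate_succ] at h
    | cons x a =>
      simp only [List.replicate_succ, List.cons_append, List.cons.injEq] at h
      exact ih a h.2

theorem isTurn_singleTurnPath (m r c : ℕ) : IsTurn (singleTurnPath m) r c ↔ r = 4 ∧ c = 2 := by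
  constructor
  · rintro ⟨a, b, h, rfl, rfl⟩
    change DyckStep.U :: DyckStep.U :: DyckStep.D :: _ = _ at h
    match a with
    | [] => simp at h
    | [x] => simp at h
    | [x, y] =>
      simp only [List.cons_append, List.cons.injEq] at h
      rw [← h.1, ← h.2.1]
      simp
    | x :: y :: z :: a =>
      simp only [List.cons_append, List.cons.injEq] at h
      exact absurd h.2.2.2 (replicate_append_replicate_ne _ _ _ _)
  · rintro ⟨rfl, rfl⟩
    exact ⟨[DyckStep.U, DyckStep.U],
      List.replicate m DyckStep.U ++ List.replicate (m + 2) DyckStep.D,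
      by simp [singleTurnPath, List.replicate_succ], by simp, by simp⟩

/-- Both alternatives are the symmetric condition (2u + 1)(2v + 1) = 1, which makes the denominators
nonzero. -/
theorem fourMat_sim_iff {F : Type*} [Field F] (h2 : (2 : F) ≠ 0) (u v : F) :
    Sim (fourMat F 0 0) (fourMat F u v) ↔
      (v ≠ -(1 / 2) ∧ u = -(v / (2 * v + 1))) ∨ (u ≠ -(1 / 2) ∧ v = -(u / (2 * u + 1))) := by
  have key : ∀ u v : F, (v ≠ -(1 / 2) ∧ u = -(v / (2 * v + 1))) ↔ u + v + 2 * u * v = 0 := by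
    intro u v
    have hv : v ≠ -(1 / 2) ↔ 2 * v + 1 ≠ 0 := by
      rw [not_iff_not]
      constructor
      · rintro rfl
        field_simp
        ring
      · intro h
        field_simp
        linear_combination h
    rw [hv]
    constructor
    · rintro ⟨h, hu⟩
      linear_combination (1 + 2 * v) * hu - div_mul_cancel₀ v h
    · intro h
      have hne : 2 * v + 1 ≠ 0 := fun h' => one_ne_zero (α := F) (by
        linear_combination (2 * u + 1) * h' - 2 * h)
      refine ⟨hne, mul_right_cancel₀ hne ?_⟩
      rw [neg_mul, div_mul_cancel₀ _ hne]
      linear_combination h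
  rw [key, key, show v + u + 2 * v * u = u + v + 2 * u * v by ring, or_self]
  refine ⟨fun h => ?_, fourMat_sim⟩
  have := (quadratic_of_fourMat_sim h2 (fourMat_bounded u v) (fourMat_detects_zero h2 u v) h).2
  simp [fourMat] at this
  linear_combination this

end SLTM

theorem mainTheorem6 (F : Type*) [Field F] (hF : ringChar F ≠ 2) :
    -- the Catalan bound is strict
    (∀ n : ℕ, 4 ≤ n → (catalan (n - 1) : Cardinal) < SLTM.numClasses n F) ∧
    -- `n ≥ 5`: the explicit matrix is equivalent to no `Ψ(P)`; it shares wall and measure sequence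
    -- with some `Ψ(P)`, from which it is separated by the `(I, J)`-test
    (∀ n : ℕ, 5 ≤ n →
      (∀ P : DyckWord, P.semilength = n - 1 →
        ¬ SLTM.Sim (SLTM.extra n F) (SLTM.Psi n F P)) ∧
      ∃ P : DyckWord, P.semilength = n - 1 ∧
        (∀ r c : ℕ, SLTM.IsTurn P r c ↔ r = 4 ∧ c = 2) ∧
        (SLTM.extra n F).IsWallREF1 [4] ∧ (SLTM.Psi n F P).IsWallREF1 [4] ∧
        (SLTM.extra n F).IsREF2With [4] ∧ (SLTM.Psi n F P).IsREF2With [4] ∧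
        (SLTM.extra n F).IsMeasureSeq [4] [[(4, 2)]] ∧
        (SLTM.Psi n F P).IsMeasureSeq [4] [[(4, 2)]] ∧
        ¬ SLTM.IJCompatible (SLTM.extra n F) (SLTM.Psi n F P) [4] [[(4, 2)]]) ∧
    -- `n = 4`: the matrices `fourMat F u v` in the class of `fourMat F 0 0`, and the resulting
    -- separation from every `Ψ(P)`
    (∀ u v : F, SLTM.Sim (SLTM.fourMat F 0 0) (SLTM.fourMat F u v) ↔
      (v ≠ -(1 / 2) ∧ u = -(v / (2 * v + 1))) ∨ (u ≠ -(1 / 2) ∧ v = -(u / (2 * u + 1)))) ∧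
    (∀ P : DyckWord, P.semilength = 3 →
      ¬ SLTM.Sim (SLTM.fourMat F 0 0) (SLTM.Psi 4 F P)) := by
  have h2 : (2 : F) ≠ 0 := Ring.two_ne_zero hF
  refine ⟨fun n hn => SLTM.catalan_lt_numClasses F h2 hn, fun n hn => ⟨fun P _ =>
    SLTM.not_sim_extra_full h2 hn (SLTM.Psi_full n F P) (SLTM.psiLength_ne_one n P), ?_⟩,
    SLTM.fourMat_sim_iff h2, fun P _ => ?_⟩
  · have hP := SLTM.isTurn_singleTurnPath (n - 4)
    have hT := SLTM.extra_oneBrick F hn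
    have hS := SLTM.Psi_oneBrick F hn hP
    refine ⟨SLTM.singleTurnPath (n - 4), ?_, hP, hT.isWallREF1 h2 hn, hS.isWallREF1 h2 hn,
      hT.isREF2With h2 hn ?_, hS.isREF2With h2 hn ?_, hT.isMeasureSeq hn, hS.isMeasureSeq hn,
      SLTM.not_ijCompatible_extra_Psi F hn hP _⟩
    · rw [SLTM.singleTurnPath_semilength]
      omega
    · exact SLTM.not_sim_zero_of_detects h2 (SLTM.extra_bounded F hn) (SLTM.extra_detects h2 hn 0)
        (i := ⟨3, by omega⟩) (by unfold SLTM.extraLength; split_ifs <;> simp at *)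
    · have hfull := SLTM.Psi_full n F (SLTM.singleTurnPath (n - 4))
      refine SLTM.not_sim_zero_of_detects h2 hfull.toBounded
        (hfull.detects_zero h2 (SLTM.psiLength_ne_one n _)) (i := ⟨3, by omega⟩) ?_
      exact (SLTM.lt_psiLength_iff.2 ⟨4, 2, (hP 4 2).2 ⟨rfl, rfl⟩, le_rfl, by decide⟩).ne'
  · rw [SLTM.Psi_eq_stair]
    refine SLTM.not_sim_fourMat_stair h2 one_ne_zero ?_ _ (SLTM.psiLength_mono 4 P)
      (SLTM.psiLength_ne_one 4 P)
    -- At μ = 1 the polynomial μ² + μ + 2 takes the value 4 = 2².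
    intro h
    exact pow_ne_zero 2 h2 (by linear_combination h)
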